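/- Let $(W,S)$ be a Coxeter system of finite rank with a geometric representation: a faithful representation of $W$ on a real vector space $V$ with a symmetric bilinear form $B$, in which each $s\in S$ acts as the $B$-reflection $s_{\alpha_s}:v\mapsto v-2B(\alpha_s,v)\alpha_s$, where $\Delta=\{\alpha_s\mid s\in S\}$ is a simple system (that is, $\Delta$ is positively linearly independent, $B(\alpha,\alpha)=1$ for $\alpha\in\Delta$, and $B(\alpha,\beta)\in\,]-\infty,-1]\cup\{-\cos(\pi/k)\mid k\in\mathbb N_{\ge 2}\}$ for distinct $\alpha,\beta\in\Delta$). Let $\Phi=W(\Delta)$ be its root system, $\Phi^+=\Phi\cap\operatorname{cone}(\Delta)$ and $\Phi^-=-\Phi^+$. For $\beta\in\Phi$ let $s_\beta\in W$ be the corresponding reflection, and for $w\in W$ let $N(w)=\Phi^+\cap w(\Phi^-)$. For $\alpha,\beta\in\Phi^+$ write $\alpha\preceq\beta$ if, for all $w\in W$, $\beta\in N(w)$ implies $\alpha\in N(w)$. The $\infty$-depth of $\beta\in\Phi^+$ is $\mathrm{dp}_\infty(\beta)=|\{\alpha\in\Phi^+\mid \alpha\preceq\beta,\ \alpha\ne\beta\}|$.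 For a reflection subgroup $W'$ of $W$ (a subgroup generated by reflections $s_\beta$, $\beta\in\Phi^+$) put $\Phi_{W'}=\{\beta\in\Phi\mid s_\beta\in W'\}$, $\Phi_{W'}^+=\Phi_{W'}\cap\Phi^+$ and $\Delta_{W'}=\{\alpha\in\Phi^+\mid N(s_\alpha)\cap\Phi_{W'}=\{\alpha\}\}$, and let $\ell_{W'}$ be the length function of $W'$ with respect to the generating set $\{s_\alpha\mid\alpha\in\Delta_{W'}\}$. Let $W'$ be a dihedral reflection subgroup of $W$, i.e. $W'=\langle s_\alpha,s_\beta\rangle$ for two distinct $\alpha,\beta\in\Phi^+$, and let $\gamma,\delta\in\Phi^+_{W'}$. (1) If $W'$ is infinite and $\ell_{W'}(s_\gamma)<\ell_{W'}(s_\delta)$, then $\mathrm{dp}_\infty(\gamma)<\mathrm{dp}_\infty(\delta)$. (2) If $W'$ is finite and there exists $x\in W'$ such that $\delta=x(\gamma)$ and $\ell_{W'}(s_\delta)=\ell_{W'}(s_\gamma)+2\ell_{W'}(x)$, then $\mathrm{dp}_\infty(\gamma)\le\mathrm{dp}_\infty(\delta)$. -/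

import Mathlib

/-- The `B`-reflection `s_α(v) = v - 2 (B(α,v) / B(α,α)) α`. -/
noncomputable def orthReflection {V : Type*} [AddCommGroup V] [Module ℝ V]
    (B : LinearMap.BilinForm ℝ V) (α : V) : V →ₗ[ℝ] V :=
  LinearMap.id - ((2 / B α α) • B α).smulRight α

/-- A geometric representation of the finite rank Coxeter system `cs`: a faithful linear
representation of `W` on a real quadratic space `(V, B)`, sending each simple reflection to the
`B`-reflection in the corresponding vector of a simple system. The simple roots need not be
linearly independent, only positively linearly independent. -/
structure GeomRep {ι W : Type*} [Fintype ι] [Group W] {M : CoxeterMatrix ι}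
    (cs : CoxeterSystem M W) (V : Type*) [AddCommGroup V] [Module ℝ V] where
  /-- the bilinear form `B` -/
  form : LinearMap.BilinForm ℝ V
  form_symm : ∀ u v : V, form u v = form v u
  /-- the simple roots `α_s` -/
  simpleRoot : ι → V
  pos_indep : ∀ a : ι → ℝ, (∀ i, 0 ≤ a i) → ∑ i, a i • simpleRoot i = 0 → ∀ i, a i = 0
  form_offDiag : ∀ i j : ι, i ≠ j →
    form (simpleRoot i) (simpleRoot j) ≤ -1 ∨
      ∃ k : ℕ, 2 ≤ k ∧ form (simpleRoot i) (simpleRoot j) = -Real.cos (Real.pi / k)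
  form_diag : ∀ i : ι, form (simpleRoot i) (simpleRoot i) = 1
  /-- the representation of `W` -/
  rep : Representation ℝ W V
  rep_faithful : Function.Injective rep
  rep_simple : ∀ i : ι, rep (cs.simple i) = orthReflection form (simpleRoot i)

namespace GeomRep

variable {ι W : Type*} [Fintype ι] [Group W] {M : CoxeterMatrix ι} {cs : CoxeterSystem M W}
  {V : Type*} [AddCommGroup V] [Module ℝ V] (G : GeomRep cs V)

/-- The root system `Φ = W(Δ)`. -/
def roots : Set V := {β | ∃ (w : W) (i : ι), β = G.rep w (G.simpleRoot i)}

/-- The positive roots `Φ⁺ = cone(Δ) ∩ Φ`. -/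
def posRoots : Set V :=
  {β | β ∈ G.roots ∧ ∃ a : ι → ℝ, (∀ i, 0 ≤ a i) ∧ β = ∑ i, a i • G.simpleRoot i}

/-- The negative roots `Φ⁻ = -Φ⁺`. -/
def negRoots : Set V := {β | -β ∈ G.posRoots}

/-- The inversion set `N(w) = Φ⁺ ∩ w(Φ⁻)`. -/
def inversionSet (w : W) : Set V := G.posRoots ∩ G.rep w '' G.negRoots

/-- The dominance order `α ⪯ β` on positive roots. -/
def Dominated (α β : V) : Prop := ∀ w : W, β ∈ G.inversionSet w → α ∈ G.inversionSet w

/-- `Dom(β)`: the positive roots strictly dominated by `β`. -/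
def dom (β : V) : Set V := {α | α ∈ G.posRoots ∧ G.Dominated α β ∧ α ≠ β}

/-- The `∞`-depth `dp_∞(β) = |Dom(β)|`. -/
noncomputable def infDepth (β : V) : ℕ∞ := (G.dom β).encard

open Classical in
/-- The reflection `s_β`, for a root `β`, as an element of `W`: the element acting on `V` as the
`B`-reflection in `β` (it exists by `rep_reflection` below, and is unique by faithfulness;
the value `1` is only taken at vectors whose reflection is not in `W`). -/
noncomputable def reflection (β : V) : W :=
  if h : ∃ t : W, G.rep t = orthReflection G.form β then h.choose else 1

/-- `W'` is a dihedral reflection subgroup: it is generated by the reflections in two distinct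
positive roots. -/
def IsDihedralReflectionSubgroup (W' : Subgroup W) : Prop :=
  ∃ α ∈ G.posRoots, ∃ β ∈ G.posRoots, α ≠ β ∧
    W' = Subgroup.closure {G.reflection α, G.reflection β}

/-- `Φ_{W'} = {β ∈ Φ | s_β ∈ W'}`. -/
def subRoots (W' : Subgroup W) : Set V := {β | β ∈ G.roots ∧ G.reflection β ∈ W'}

/-- `Φ_{W'}⁺ = Φ_{W'} ∩ Φ⁺`. -/
def subPosRoots (W' : Subgroup W) : Set V := G.subRoots W' ∩ G.posRoots

/-- The canonical simple system `Δ_{W'} = {α ∈ Φ⁺ | N(s_α) ∩ Φ_{W'} = {α}}`. -/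
def canonicalSimpleRoots (W' : Subgroup W) : Set V :=
  {α | α ∈ G.posRoots ∧ G.inversionSet (G.reflection α) ∩ G.subRoots W' = {α}}

/-- The canonical simple reflections `S' = {s_α | α ∈ Δ_{W'}}` of `W'`. -/
def canonicalReflections (W' : Subgroup W) : Set W :=
  G.reflection '' G.canonicalSimpleRoots W'

/-- The length function `ℓ_{W'}` of `(W', S')`: the least length of a word in `S'` with
product `w`, for `w ∈ W'`. -/
noncomputable def subLength (W' : Subgroup W) (w : W) : ℕ :=
  sInf {n | ∃ l : List W, (∀ x ∈ l, x ∈ G.canonicalReflections W') ∧ l.prod = w ∧ l.length = n}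

theorem orthReflection_form (B : LinearMap.BilinForm ℝ V) (hB : ∀ u v, B u v = B v u) (α : V)
    (hα : B α α = 1) (u v : V) :
    B (orthReflection B α u) (orthReflection B α v) = B u v := by
  simp [orthReflection, hα, hB u α]
  ring

theorem rep_form (w : W) (u v : V) : G.form (G.rep w u) (G.rep w v) = G.form u v := by
  induction w using cs.simple_induction generalizing u v with
  | simple i =>
    rw [G.rep_simple]
    exact orthReflection_form _ G.form_symm _ (G.form_diag i) u v
  | one => simp
  | mul x y hx hy => simp [hx, hy]

/-- Every reflection in a root is realised by an element of `W`. -/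
theorem rep_reflection {β : V} (hβ : β ∈ G.roots) :
    G.rep (G.reflection β) = orthReflection G.form β := by
  have h : ∃ t : W, G.rep t = orthReflection G.form β := by
    obtain ⟨w, i, rfl⟩ := hβ
    refine ⟨w * cs.simple i * w⁻¹, ?_⟩
    ext v
    have h1 : G.rep w (G.rep w⁻¹ v) = v := by simp
    have h2 := G.rep_form w (G.simpleRoot i) (G.rep w⁻¹ v)
    rw [h1] at h2
    simp [G.rep_simple, orthReflection, G.rep_form, G.form_diag, h2]
  rw [reflection, dif_pos h]
  exact h.choose_spec

end GeomRep

/-! Dominance is extended to a relation `Below` on all roots, which is invariant under W and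
reversed by negation. Two facts about it carry the theorem. By `below_or_below`, roots x, y with
B(x,y) ≥ 1 are comparable: otherwise some inversion set would contain infinitely many roots from the
plane of x and y. By `exists_injOn_dom`, if β, γ are positive and B(β,γ) ≤ 0, then Dom(γ) injects
into Dom(s_β γ), so the ∞-depth does not drop from γ to s_β γ. It strictly grows when -β is below γ,
because β is then a new dominated root (`infDepth_lt_reflection`).

For (2), write x as a shortest word in the canonical reflections of W'. Applying a letter to a root
raises the length of its reflection by at most 2, so the length hypothesis forces a rise of exactly
2 at every letter. By the exchange condition the form is then nonpositive at each step, and the weak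
inequality is iterated (`infDepth_le_of_word`).

For (1), an infinite dihedral W' has exactly two canonical simple roots α, β, and B(α,β) ≤ -1
(`form_le_neg_one`). Its positive roots form the two chains `rootChain n α β` and `rootChain n β α`,
with reflections of length 2n+1. Each chain increases strictly in dominance. Passing from place n of
one chain to place n+1 of the other is a reflection in α or β to which the strict inequality
applies. So the ∞-depth grows with n, whichever chains are compared.

The background is developed for simple roots that are only positively independent: every root is
positive or negative, inversion sets are finite, and reflection subgroups are generated by their
canonical reflections. -/

namespace CoxeterSystem

variable {ι W : Type*} [Group W] {M : CoxeterMatrix ι} (cs : CoxeterSystem M W)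

/-! ### Alternating words and rank-two factorizations -/

theorem exists_eq_append_alternatingWord (i j : ι) {k n : ℕ} (h : k ≤ n) :
    ∃ l : List ι, l.length + k = n ∧ alternatingWord i j n = l ++ alternatingWord i j k := by
  induction n, h using Nat.le_induction with
  | base => exact ⟨[], by simp, rfl⟩
  | succ n _ ih =>
    obtain ⟨l, hl, h⟩ := ih
    exact ⟨(if Even n then j else i) :: l, by simp; omega, by
      rw [alternatingWord_succ', h, List.cons_append]⟩

/-- If `w` can be shortened on the right by `j`, then an alternating word in `i`, `j` can be split
off on the right so that no further shortening by `i` or `j` is possible. -/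
theorem exists_mul_alternatingWord (N : ℕ) :
    ∀ (w : W) (i j : ι), cs.length w = N → cs.length (w * cs.simple j) < cs.length w →
    ∃ (v : W) (n : ℕ), w = v * cs.wordProd (alternatingWord i j (n + 1)) ∧
      cs.length w = cs.length v + (n + 1) ∧ cs.length v < cs.length (v * cs.simple i) ∧
      cs.length v < cs.length (v * cs.simple j) := by
  induction N with
  | zero =>
    intro w i j hw h
    omega
  | succ N ih =>
    intro w i j hw h
    have hl : cs.length (w * cs.simple j) + 1 = cs.length w := by
      rcases cs.length_mul_simple w j with h' | h' <;> omega
    by_cases hi : cs.length (w * cs.simple j * cs.simple i) < cs.length (w * cs.simple j)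
    -- The word is peeled off from its last letter, so i and j exchange roles at each step.
    · obtain ⟨v, n, h1, h2, h3, h4⟩ := ih (w * cs.simple j) j i (by omega) hi
      refine ⟨v, n + 1, ?_, by omega, h4, h3⟩
      rw [alternatingWord_succ, wordProd_concat, ← mul_assoc, ← h1]
      simp
    · refine ⟨w * cs.simple j, 0, by simp [alternatingWord], by omega, ?_, by simpa using h⟩
      have := cs.length_mul_simple_ne (w * cs.simple j) i
      omega

end CoxeterSystem

namespace GeomRep

variable {ι W : Type*} [Fintype ι] [Group W] {M : CoxeterMatrix ι} {cs : CoxeterSystem M W}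
  {V : Type*} [AddCommGroup V] [Module ℝ V] (G : GeomRep cs V)

/-! ### The cone of the simple roots -/

/-- `v` is a nonnegative combination of simple roots. -/
def InCone (v : V) : Prop := ∃ a : ι → ℝ, (∀ i, 0 ≤ a i) ∧ v = ∑ i, a i • G.simpleRoot i

variable {G}

theorem InCone.add {u v : V} (hu : G.InCone u) (hv : G.InCone v) : G.InCone (u + v) := by
  obtain ⟨a, ha, rfl⟩ := hu
  obtain ⟨b, hb, rfl⟩ := hv
  exact ⟨a + b, fun i => add_nonneg (ha i) (hb i), by simp [add_smul, Finset.sum_add_distrib]⟩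

theorem InCone.smul {c : ℝ} (hc : 0 ≤ c) {v : V} (hv : G.InCone v) : G.InCone (c • v) := by
  obtain ⟨a, ha, rfl⟩ := hv
  exact ⟨fun i => c * a i, fun i => mul_nonneg hc (ha i), by simp [Finset.smul_sum, mul_smul]⟩

theorem InCone.eq_zero {v : V} (hv : G.InCone v) (hv' : G.InCone (-v)) : v = 0 := by
  obtain ⟨a, ha, rfl⟩ := hv
  obtain ⟨b, hb, hab⟩ := hv'
  have h := G.pos_indep (a + b) (fun i => add_nonneg (ha i) (hb i)) (by
    simp only [Pi.add_apply, add_smul, Finset.sum_add_distrib, ← hab, add_neg_cancel])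
  have h0 : ∀ i, a i = 0 := fun i => by
    have := h i
    have := ha i
    have := hb i
    simp only [Pi.add_apply] at *
    linarith
  simp [h0]

variable (G)

theorem inCone_simpleRoot (i : ι) : G.InCone (G.simpleRoot i) := by
  classical
  exact ⟨Pi.single i 1, fun j => by by_cases h : j = i <;> simp [h],
    by simp [Pi.single_apply]⟩

theorem form_simpleRoot_nonpos {i j : ι} (h : i ≠ j) :
    G.form (G.simpleRoot i) (G.simpleRoot j) ≤ 0 := by
  rcases G.form_offDiag i j h with h | ⟨k, hk, h⟩
  · linarith
  · rw [h, neg_nonpos]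
    have hk' : (2 : ℝ) ≤ k := by exact_mod_cast hk
    apply Real.cos_nonneg_of_neg_pi_div_two_le_of_le
    · have := Real.pi_pos
      have : 0 ≤ Real.pi / k := by positivity
      linarith
    · exact div_le_div_of_nonneg_left Real.pi_pos.le (by norm_num) hk'

/-! ### Roots and reflections -/

theorem simpleRoot_mem_roots (i : ι) : G.simpleRoot i ∈ G.roots := ⟨1, i, by simp⟩

variable {G}

theorem rep_mem_roots {β : V} (hβ : β ∈ G.roots) (w : W) : G.rep w β ∈ G.roots := by
  obtain ⟨x, i, rfl⟩ := hβ
  exact ⟨w * x, i, by simp⟩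

theorem form_self {β : V} (hβ : β ∈ G.roots) : G.form β β = 1 := by
  obtain ⟨w, i, rfl⟩ := hβ
  rw [G.rep_form, G.form_diag]

theorem ne_zero_of_mem_roots {β : V} (hβ : β ∈ G.roots) : β ≠ 0 := by
  rintro rfl
  simpa using form_self hβ

theorem rep_reflection_apply {β : V} (hβ : β ∈ G.roots) (v : V) :
    G.rep (G.reflection β) v = v - (2 * G.form β v) • β := by
  simp [G.rep_reflection hβ, orthReflection, form_self hβ]

theorem rep_simple_apply (i : ι) (v : V) :
    G.rep (cs.simple i) v = v - (2 * G.form (G.simpleRoot i) v) • G.simpleRoot i := by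
  simp [G.rep_simple, orthReflection, G.form_diag]

theorem rep_reflection_self {β : V} (hβ : β ∈ G.roots) : G.rep (G.reflection β) β = -β := by
  rw [rep_reflection_apply hβ, form_self hβ]
  module

theorem neg_mem_roots {β : V} (hβ : β ∈ G.roots) : -β ∈ G.roots := by
  rw [← rep_reflection_self hβ]
  exact rep_mem_roots hβ _

variable (G)

theorem eq_of_rep {x y : W} (h : ∀ v, G.rep x v = G.rep y v) : x = y :=
  G.rep_faithful (LinearMap.ext h)

variable {G}

theorem rep_inv_apply_apply (w : W) (v : V) : G.rep w⁻¹ (G.rep w v) = v := by simp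

theorem rep_apply_inv_apply (w : W) (v : V) : G.rep w (G.rep w⁻¹ v) = v := by simp

theorem rep_mul_apply (x y : W) (v : V) : G.rep (x * y) v = G.rep x (G.rep y v) := by simp

theorem reflection_rep {β : V} (hβ : β ∈ G.roots) (w : W) :
    G.reflection (G.rep w β) = w * G.reflection β * w⁻¹ := by
  apply G.eq_of_rep
  intro v
  have h := G.rep_form w β (G.rep w⁻¹ v)
  rw [rep_apply_inv_apply] at h
  rw [rep_reflection_apply (rep_mem_roots hβ w), rep_mul_apply, rep_mul_apply,
    rep_reflection_apply hβ, map_sub, map_smul, rep_apply_inv_apply, h]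

variable (G) in
theorem reflection_simpleRoot (i : ι) : G.reflection (G.simpleRoot i) = cs.simple i := by
  apply G.eq_of_rep
  intro v
  rw [rep_reflection_apply (G.simpleRoot_mem_roots i), rep_simple_apply]

theorem reflection_mul_self {β : V} (hβ : β ∈ G.roots) :
    G.reflection β * G.reflection β = 1 := by
  apply G.eq_of_rep
  intro v
  rw [rep_mul_apply, rep_reflection_apply hβ, rep_reflection_apply hβ]
  simp [form_self hβ]
  module

theorem reflection_inv {β : V} (hβ : β ∈ G.roots) : (G.reflection β)⁻¹ = G.reflection β :=
  inv_eq_of_mul_eq_one_right (reflection_mul_self hβ)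

theorem rep_reflection_reflection {β : V} (hβ : β ∈ G.roots) (v : V) :
    G.rep (G.reflection β) (G.rep (G.reflection β) v) = v := by
  rw [← rep_mul_apply, reflection_mul_self hβ]
  simp

theorem reflection_ne_one {β : V} (hβ : β ∈ G.roots) : G.reflection β ≠ 1 := by
  intro h
  have h1 := rep_reflection_self hβ
  rw [h, map_one] at h1
  have h2 : (2 : ℝ) • β = 0 := by
    rw [two_smul]
    nth_rewrite 1 [show β = -β from h1]
    simp
  exact ne_zero_of_mem_roots hβ (by simpa using h2)

/-! ### Every root is positive or negative -/

/-- The sequence `0, 1, 2c, …` of Chebyshev values `U_{n-1}(c)`. -/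
def chebSeq (c : ℝ) : ℕ → ℝ
  | 0 => 0
  | 1 => 1
  | n + 2 => 2 * c * chebSeq c (n + 1) - chebSeq c n

theorem chebSeq_mul_sin (θ : ℝ) (n : ℕ) :
    chebSeq (Real.cos θ) n * Real.sin θ = Real.sin (n * θ) ∧
      chebSeq (Real.cos θ) (n + 1) * Real.sin θ = Real.sin ((n + 1) * θ) := by
  induction n with
  | zero => simp [chebSeq]
  | succ n ih =>
    refine ⟨by simpa using ih.2, ?_⟩
    rw [chebSeq, sub_mul, mul_assoc, ih.2, ih.1]
    push_cast
    rw [show ((n : ℝ) + 1 + 1) * θ = (n + 1) * θ + θ by ring,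
      show (n : ℝ) * θ = (n + 1) * θ - θ by ring, Real.sin_add, Real.sin_sub]
    ring

theorem chebSeq_nonneg_of_one_le {c : ℝ} (hc : 1 ≤ c) (n : ℕ) :
    0 ≤ chebSeq c n ∧ chebSeq c n ≤ chebSeq c (n + 1) := by
  induction n with
  | zero => simp [chebSeq]
  | succ n ih =>
    have h := ih.1.trans ih.2
    refine ⟨h, ?_⟩
    rw [chebSeq]
    nlinarith [mul_nonneg (sub_nonneg.2 hc) h]

theorem sin_pi_div_pos {k : ℕ} (hk : 2 ≤ k) : 0 < Real.sin (Real.pi / k) := by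
  have hk' : (2 : ℝ) ≤ k := by exact_mod_cast hk
  apply Real.sin_pos_of_pos_of_lt_pi
  · have := Real.pi_pos
    positivity
  · rw [div_lt_iff₀ (by linarith)]
    nlinarith [Real.pi_pos]

theorem chebSeq_cos_nonneg {k : ℕ} (hk : 2 ≤ k) {n : ℕ} (hn : n ≤ k) :
    0 ≤ chebSeq (Real.cos (Real.pi / k)) n := by
  have hk' : (2 : ℝ) ≤ k := by exact_mod_cast hk
  have hn' : (n : ℝ) ≤ k := by exact_mod_cast hn
  refine nonneg_of_mul_nonneg_left ?_ (sin_pi_div_pos hk)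
  rw [(chebSeq_mul_sin _ n).1]
  apply Real.sin_nonneg_of_nonneg_of_le_pi
  · have := Real.pi_pos
    positivity
  · rw [← mul_div_assoc, div_le_iff₀ (by linarith)]
    nlinarith [Real.pi_pos]

theorem chebSeq_cos_self {k : ℕ} (hk : 2 ≤ k) : chebSeq (Real.cos (Real.pi / k)) k = 0 := by
  have hk' : (2 : ℝ) ≤ k := by exact_mod_cast hk
  have h := (chebSeq_mul_sin (Real.pi / k) k).1
  rw [mul_div_cancel₀ _ (by linarith), Real.sin_pi] at h
  exact (mul_eq_zero.1 h).resolve_right (sin_pi_div_pos hk).ne'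

theorem chebSeq_cos_pred {k : ℕ} (hk : 1 ≤ k) :
    chebSeq (Real.cos (Real.pi / (k + 1 : ℕ))) k = 1 := by
  have h := (chebSeq_mul_sin (Real.pi / (k + 1 : ℕ)) k).1
  have hk' : (0 : ℝ) < k + 1 := by positivity
  rw [show (k : ℝ) * (Real.pi / (k + 1 : ℕ)) = Real.pi - Real.pi / (k + 1 : ℕ) by
    push_cast
    field_simp
    ring, Real.sin_pi_sub] at h
  exact mul_right_cancel₀ (sin_pi_div_pos (k := k + 1) (by omega)).ne' (by rw [h, one_mul])

open CoxeterSystem in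
variable (G) in
-- In the plane of two simple roots the coefficients obey the Chebyshev recurrence with c = -B(α_i,
-- α_j); their signs decide positivity in rank two.
theorem rep_alternatingWord (i j : ι) (n : ℕ) :
    G.rep (cs.wordProd (alternatingWord i j n)) (G.simpleRoot i) =
      if Even n then
        chebSeq (-G.form (G.simpleRoot i) (G.simpleRoot j)) (n + 1) • G.simpleRoot i +
          chebSeq (-G.form (G.simpleRoot i) (G.simpleRoot j)) n • G.simpleRoot j
      else
        chebSeq (-G.form (G.simpleRoot i) (G.simpleRoot j)) n • G.simpleRoot i +
          chebSeq (-G.form (G.simpleRoot i) (G.simpleRoot j)) (n + 1) • G.simpleRoot j := by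
  have hs := G.form_symm (G.simpleRoot j) (G.simpleRoot i)
  induction n with
  | zero => simp [alternatingWord, chebSeq]
  | succ n ih =>
    rw [alternatingWord_succ', CoxeterSystem.wordProd_cons, rep_mul_apply, ih]
    by_cases hn : Even n
    · simp only [hn, if_true, Nat.even_add_one, not_true_eq_false, if_false]
      rw [rep_simple_apply, chebSeq]
      simp only [map_add, map_smul, smul_eq_mul, G.form_diag, hs]
      module
    · simp only [hn, if_false, Nat.even_add_one, not_false_eq_true, if_true]
      rw [rep_simple_apply, chebSeq]
      simp only [map_add, map_smul, smul_eq_mul, G.form_diag]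
      module

variable (G) in
open CoxeterSystem in
-- Factor w = v·u with u alternating in i, j and v not shortened by either. By induction v sends α_i
-- and α_j into the cone, so it suffices that u α_i is a nonnegative combination of them.
theorem inCone_of_length_lt (N : ℕ) : ∀ (w : W) (i : ι), cs.length w = N →
    cs.length w < cs.length (w * cs.simple i) → G.InCone (G.rep w (G.simpleRoot i)) := by
  induction N using Nat.strong_induction_on with
  | _ N ih =>
  intro w i hN hw
  rcases eq_or_ne w 1 with rfl | hw1
  · simpa using G.inCone_simpleRoot i
  obtain ⟨j, hj⟩ := cs.exists_rightDescent_of_ne_one hw1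
  have hij : i ≠ j := by
    rintro rfl
    exact absurd hj (by simp only [CoxeterSystem.IsRightDescent]; omega)
  obtain ⟨v, n, h1, h2, h3, h4⟩ := cs.exists_mul_alternatingWord N w i j hN hj
  have hvi := ih (cs.length v) (by omega) v i rfl h3
  have hvj := ih (cs.length v) (by omega) v j rfl h4
  have key : 0 ≤ chebSeq (-G.form (G.simpleRoot i) (G.simpleRoot j)) (n + 1) ∧
      0 ≤ chebSeq (-G.form (G.simpleRoot i) (G.simpleRoot j)) (n + 1 + 1) := by
    rcases G.form_offDiag i j hij with h | ⟨k, hk, h⟩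
    · have hc : 1 ≤ -G.form (G.simpleRoot i) (G.simpleRoot j) := by linarith
      exact ⟨(chebSeq_nonneg_of_one_le hc _).1, (chebSeq_nonneg_of_one_le hc _).1⟩
    · rw [h, neg_neg]
      by_cases hnk : n + 1 < k
      · exact ⟨chebSeq_cos_nonneg hk (by omega), chebSeq_cos_nonneg hk (by omega)⟩
      -- If u is too long for the Chebyshev values to be known nonnegative, its suffix of length k -
      -- 1 sends α_i to a simple root. By faithfulness this gives a braid relation, which makes w
      -- s_i shorter than w. Below, k is renamed to k + 1.
      · exfalso
        obtain ⟨k, rfl⟩ : ∃ m, k = m + 1 := ⟨k - 1, by omega⟩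
        obtain ⟨l, hl, hl'⟩ := exists_eq_append_alternatingWord i j (k := k + 1) (n := n + 1)
          (by omega)
        have hrep := G.rep_alternatingWord i j k
        rw [h, neg_neg, chebSeq_cos_self hk, chebSeq_cos_pred (by omega)] at hrep
        have hrep' : G.rep (cs.wordProd (alternatingWord i j k)) (G.simpleRoot i) =
            G.simpleRoot (if Even k then j else i) := by
          rw [hrep]
          split_ifs <;> simp
        have hconj := reflection_rep (G.simpleRoot_mem_roots i)
          (cs.wordProd (alternatingWord i j k))
        rw [hrep', reflection_simpleRoot, reflection_simpleRoot] at hconj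
        have hws : w * cs.simple i = v * cs.wordProd (l ++ alternatingWord i j k) := by
          rw [h1, hl', alternatingWord_succ', CoxeterSystem.wordProd_append,
            CoxeterSystem.wordProd_cons, CoxeterSystem.wordProd_append, hconj]
          simp [mul_assoc]
        have hle : cs.length (w * cs.simple i) ≤ cs.length v + (l.length + k) := by
          rw [hws]
          refine (cs.length_mul_le _ _).trans (Nat.add_le_add_left ?_ _)
          refine (cs.length_wordProd_le _).trans ?_
          simp
        omega
  rw [h1, rep_mul_apply, rep_alternatingWord]
  split_ifs
  · simpa using (hvi.smul key.2).add (hvj.smul key.1)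
  · simpa using (hvi.smul key.1).add (hvj.smul key.2)

variable (G) in
theorem inCone_or_inCone_neg {β : V} (hβ : β ∈ G.roots) : G.InCone β ∨ G.InCone (-β) := by
  obtain ⟨w, i, rfl⟩ := hβ
  rcases cs.length_mul_simple w i with h | h
  · exact Or.inl (G.inCone_of_length_lt _ w i rfl (by omega))
  · refine Or.inr ?_
    have := G.inCone_of_length_lt _ (w * cs.simple i) i rfl (by simp; omega)
    rw [rep_mul_apply, ← G.reflection_simpleRoot, rep_reflection_self (G.simpleRoot_mem_roots i),
      map_neg] at this
    exact this

theorem inCone_of_pos {β : V} (hβ : β ∈ G.posRoots) : G.InCone β := hβ.2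

theorem inCone_neg_of_neg {β : V} (hβ : β ∈ G.negRoots) : G.InCone (-β) := hβ.2

theorem mem_negRoots {β : V} : β ∈ G.negRoots ↔ -β ∈ G.posRoots := Iff.rfl

theorem mem_posRoots_or {β : V} (hβ : β ∈ G.roots) : β ∈ G.posRoots ∨ β ∈ G.negRoots := by
  rcases G.inCone_or_inCone_neg hβ with h | h
  · exact Or.inl ⟨hβ, h⟩
  · exact Or.inr ⟨neg_mem_roots hβ, h⟩

theorem mem_roots_of_neg {β : V} (hβ : β ∈ G.negRoots) : β ∈ G.roots := by
  simpa using neg_mem_roots hβ.1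

theorem not_neg_of_inCone {β : V} (hβ : G.InCone β) : β ∉ G.negRoots := fun h =>
  ne_zero_of_mem_roots (mem_roots_of_neg h) (hβ.eq_zero h.2)

theorem not_neg_of_pos {β : V} (hβ : β ∈ G.posRoots) : β ∉ G.negRoots :=
  not_neg_of_inCone hβ.2

theorem pos_of_not_neg {β : V} (hβ : β ∈ G.roots) (h : β ∉ G.negRoots) : β ∈ G.posRoots :=
  (mem_posRoots_or hβ).resolve_right h

theorem neg_of_not_pos {β : V} (hβ : β ∈ G.roots) (h : β ∉ G.posRoots) : β ∈ G.negRoots :=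
  (mem_posRoots_or hβ).resolve_left h

theorem neg_mem_negRoots {β : V} (hβ : β ∈ G.posRoots) : -β ∈ G.negRoots := by
  simpa [mem_negRoots] using hβ

theorem not_pos_of_neg {β : V} (hβ : β ∈ G.negRoots) : β ∉ G.posRoots := fun h =>
  not_neg_of_pos h hβ

variable (G) in
theorem simpleRoot_mem_posRoots (i : ι) : G.simpleRoot i ∈ G.posRoots :=
  ⟨G.simpleRoot_mem_roots i, G.inCone_simpleRoot i⟩

theorem eq_smul_cases {a b : V} (ha : a ∈ G.roots) (hb : b ∈ G.roots) {c : ℝ} (h : a = c • b) :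
    a = b ∨ a = -b := by
  have h1 := form_self ha
  rw [h] at h1
  simp only [map_smul, LinearMap.smul_apply, form_self hb, smul_eq_mul, mul_one] at h1
  rcases mul_self_eq_one_iff.1 h1 with rfl | rfl
  · left; simpa using h
  · right; simpa using h

theorem reflection_injOn : Set.InjOn G.reflection G.posRoots := by
  intro a ha b hb h
  have h1 := rep_reflection_self ha.1
  rw [h, rep_reflection_apply hb.1] at h1
  have h2 : a = G.form b a • b := by
    have h3 : (2 : ℝ) • a = (2 : ℝ) • (G.form b a • b) := by
      rw [smul_smul, two_smul, ← sub_eq_zero]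
      rw [← sub_eq_zero] at h1
      rw [← h1]
      abel
    exact smul_right_injective V (two_ne_zero' ℝ) h3
  rcases eq_smul_cases ha.1 hb.1 h2 with h | h
  · exact h
  · exact absurd (h ▸ ha) (not_pos_of_neg (neg_mem_negRoots hb))

variable (G) in
-- Coefficients are not unique, so they cannot be compared directly. If s_i x were negative, adding
-- cone expressions of x and -s_i x would give a multiple of α_i. Pairing with α_i shows that moving
-- this multiple across leaves a nonnegative relation, and positive independence makes x
-- proportional to α_i.
theorem rep_simple_pos {i : ι} {x : V} (hx : x ∈ G.posRoots) (hi : x ≠ G.simpleRoot i) :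
    G.rep (cs.simple i) x ∈ G.posRoots := by
  classical
  refine pos_of_not_neg (rep_mem_roots hx.1 _) fun hneg => ?_
  obtain ⟨a, ha, hxa⟩ := hx.2
  obtain ⟨b, hb, hxb⟩ := hneg.2
  rw [rep_simple_apply] at hxb
  set m := 2 * G.form (G.simpleRoot i) x with hm
  have hsum : ∑ j, (a j + b j) • G.simpleRoot j = m • G.simpleRoot i := by
    simp only [add_smul, Finset.sum_add_distrib]
    rw [← hxa, ← hxb]
    abel
  have hsplit : (a i + b i - m) • G.simpleRoot i +
      ∑ j ∈ Finset.univ.erase i, (a j + b j) • G.simpleRoot j = 0 := by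
    rw [← Finset.add_sum_erase _ _ (Finset.mem_univ i)] at hsum
    rw [sub_smul, ← hsum]
    abel
  have hB := congrArg (G.form (G.simpleRoot i)) hsplit
  simp only [map_add, map_smul, map_sum, map_zero, smul_eq_mul, G.form_diag] at hB
  have hB' : ∑ j ∈ Finset.univ.erase i, (a j + b j) * G.form (G.simpleRoot i) (G.simpleRoot j)
      ≤ 0 := Finset.sum_nonpos fun j hj => mul_nonpos_of_nonneg_of_nonpos
        (add_nonneg (ha j) (hb j)) (G.form_simpleRoot_nonpos (Finset.ne_of_mem_erase hj).symm)
  have h0 := G.pos_indep (fun j => if j = i then a i + b i - m else a j + b j) (fun j => by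
    by_cases h : j = i
    · simp only [h, if_true]; linarith
    · simpa only [h, if_false] using add_nonneg (ha j) (hb j)) (by
    rw [← Finset.add_sum_erase _ _ (Finset.mem_univ i), if_pos rfl, ← hsplit]
    congr 1
    exact Finset.sum_congr rfl fun j hj => by rw [if_neg (Finset.ne_of_mem_erase hj)])
  have hxi : x = a i • G.simpleRoot i := by
    rw [hxa, ← Finset.add_sum_erase _ _ (Finset.mem_univ i), add_eq_left]
    refine Finset.sum_eq_zero fun j hj => ?_
    have h1 := h0 j
    rw [if_neg (Finset.ne_of_mem_erase hj)] at h1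
    have : a j = 0 := by linarith [ha j, hb j]
    simp [this]
  rcases eq_smul_cases hx.1 (G.simpleRoot_mem_roots i) hxi with h | h
  · exact hi h
  · exact not_pos_of_neg (neg_mem_negRoots (G.simpleRoot_mem_posRoots i)) (h ▸ hx)

/-! ### Inversion sets -/

theorem mem_inversionSet {w : W} {x : V} :
    x ∈ G.inversionSet w ↔ x ∈ G.posRoots ∧ G.rep w⁻¹ x ∈ G.negRoots := by
  constructor
  · rintro ⟨h, y, hy, rfl⟩
    exact ⟨h, by rwa [rep_inv_apply_apply]⟩
  · rintro ⟨h, h'⟩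
    exact ⟨h, _, h', rep_apply_inv_apply w x⟩

variable (G) in
theorem inversionSet_finite (w : W) : (G.inversionSet w).Finite := by
  induction w using cs.simple_induction_right with
  | one =>
    convert Set.finite_empty
    ext x
    simp only [mem_inversionSet, inv_one, map_one, Module.End.one_apply, Set.mem_empty_iff_false,
      iff_false, not_and]
    exact fun h => not_neg_of_pos h
  | mul_simple_right w i ih =>
    refine (ih.union (Set.finite_singleton (G.rep w (G.simpleRoot i)))).subset ?_
    intro x hx
    rw [mem_inversionSet] at hx
    by_cases h : G.rep w⁻¹ x ∈ G.negRoots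
    · exact Or.inl (mem_inversionSet.2 ⟨hx.1, h⟩)
    · right
      have hpos := pos_of_not_neg (rep_mem_roots hx.1.1 w⁻¹) h
      by_contra hne
      have h2 := G.rep_simple_pos (i := i) hpos (fun h' => hne (by
        rw [← h', rep_apply_inv_apply]
        rfl))
      rw [← rep_mul_apply] at h2
      have h3 := hx.2
      rw [mul_inv_rev, cs.inv_simple] at h3
      exact not_neg_of_pos h2 h3

end GeomRep

namespace GeomRep

variable {ι W : Type*} [Fintype ι] [Group W] {M : CoxeterMatrix ι} {cs : CoxeterSystem M W}
  {V : Type*} [AddCommGroup V] [Module ℝ V] (G : GeomRep cs V)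

/-! ### Dominance on all roots -/

/-- The dominance relation, on all roots: `w x` is negative whenever `w y` is. -/
def Below (x y : V) : Prop := ∀ w : W, G.rep w y ∈ G.negRoots → G.rep w x ∈ G.negRoots

variable {G}

theorem dominated_iff_below {x y : V} (hx : x ∈ G.posRoots) (hy : y ∈ G.posRoots) :
    G.Dominated x y ↔ G.Below x y := by
  constructor
  · intro h w hw
    have := h w⁻¹ (mem_inversionSet.2 ⟨hy, by rwa [inv_inv]⟩)
    simpa using (mem_inversionSet.1 this).2
  · intro h w hw
    exact mem_inversionSet.2 ⟨hx, h _ (mem_inversionSet.1 hw).2⟩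

theorem Below.trans {x y z : V} (h : G.Below x y) (h' : G.Below y z) : G.Below x z :=
  fun w hw => h w (h' w hw)

theorem Below.rep {x y : V} (h : G.Below x y) (w : W) : G.Below (G.rep w x) (G.rep w y) := by
  intro v hv
  rw [← rep_mul_apply] at hv ⊢
  exact h _ hv

theorem Below.neg {x y : V} (hy : y ∈ G.roots) (h : G.Below x y) :
    G.Below (-y) (-x) := by
  intro w hw
  rw [map_neg] at hw ⊢
  rw [mem_negRoots, neg_neg] at hw ⊢
  by_contra hn
  exact not_pos_of_neg (h w (neg_of_not_pos (rep_mem_roots hy w) hn)) hw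

theorem Below.pos {x y : V} (h : G.Below x y) (hx : x ∈ G.posRoots) (hy : y ∈ G.roots) :
    y ∈ G.posRoots := by
  refine pos_of_not_neg hy fun hn => ?_
  have := h 1 (by simpa using hn)
  rw [map_one] at this
  exact not_neg_of_pos hx this

/-- Otherwise s_y x = x - 2B(y,x)y would be a sum of two vectors of the cone. -/
theorem form_pos_of_inversion {x y : V} (hx : x ∈ G.posRoots) (hy : y ∈ G.posRoots)
    (h : G.rep (G.reflection y) x ∈ G.negRoots) : 0 < G.form y x := by
  by_contra hle
  rw [rep_reflection_apply hy.1] at h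
  refine not_neg_of_inCone ?_ h
  have := (inCone_of_pos hx).add
    ((inCone_of_pos hy).smul (c := -(2 * G.form y x)) (by linarith))
  convert this using 1
  module

theorem Below.form_pos {x y : V} (h : G.Below x y) (hx : x ∈ G.posRoots) (hy : y ∈ G.posRoots) :
    0 < G.form y x :=
  form_pos_of_inversion hx hy (h _ (by
    rw [rep_reflection_self hy.1]
    exact neg_mem_negRoots hy))

theorem not_below_of_neg_below {x y : V} (hy : y ∈ G.posRoots)
    (h : G.Below (-x) y) : ¬ G.Below x y := by
  intro h'
  have hneg : G.rep (G.reflection y) y ∈ G.negRoots := by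
    rw [rep_reflection_self hy.1]
    exact neg_mem_negRoots hy
  have h1 := h _ hneg
  have h2 := h' _ hneg
  rw [map_neg] at h1
  rw [mem_negRoots, neg_neg] at h1
  exact not_neg_of_pos h1 h2

/-! ### Roots with large inner product are comparable -/

/-- Powers of s_x s_y applied to x yield roots in the cone of x and y with unbounded coefficients; q
+ 1 ≤ p is the invariant that drives the growth. -/
theorem exists_rep_eq_smul_add_smul {x y : V} (hx : x ∈ G.roots) (hy : y ∈ G.roots)
    (h : G.form x y ≤ -1) (n : ℕ) : ∃ (w : W) (p q : ℝ), G.rep w x = p • x + q • y ∧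
      (n : ℝ) ≤ p ∧ 0 ≤ q ∧ q + 1 ≤ p := by
  induction n with
  | zero => exact ⟨1, 1, 0, by simp, by simp, le_rfl, by simp⟩
  | succ n ih =>
    obtain ⟨w, p, q, hw, hp, hq, hqp⟩ := ih
    have hf := G.form_symm x y
    set c := G.form x y
    have h1 : p + 1 ≤ 2 * (-c) * p - q := by
      nlinarith [mul_nonneg (show 0 ≤ -c - 1 by linarith) (show 0 ≤ p by linarith)]
    have h2 : 2 * (-c) * p - q + 1 ≤ 2 * (-c) * (2 * (-c) * p - q) - p := by
      nlinarith [mul_nonneg (show 0 ≤ -c - 1 by linarith)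
        (show 0 ≤ 2 * (-c) * p - q by linarith)]
    refine ⟨G.reflection x * (G.reflection y * w), 2 * (-c) * (2 * (-c) * p - q) - p,
      2 * (-c) * p - q, ?_, ?_, ?_, ?_⟩
    · rw [rep_mul_apply, rep_mul_apply, hw, rep_reflection_apply hy, rep_reflection_apply hx]
      simp only [map_add, map_sub, map_smul, smul_eq_mul, form_self hx, form_self hy, ← hf]
      module
    · push_cast
      linarith
    · linarith
    · linarith

theorem smul_add_smul_injective {x y : V} (hx : x ∈ G.roots) (hy : y ∈ G.roots)
    (h : G.form x y ≤ -1) (hxy : x ≠ -y) {p q p' q' : ℝ}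
    (he : p • x + q • y = p' • x + q' • y) : p = p' := by
  by_contra hp
  have h1 : (p - p') • x = (q' - q) • y := by
    rw [sub_smul, sub_smul, sub_eq_sub_iff_add_eq_add, he, add_comm]
  have h2 : x = ((p - p')⁻¹ * (q' - q)) • y := by
    rw [mul_smul, ← h1, smul_smul, inv_mul_cancel₀ (sub_ne_zero.2 hp), one_smul]
  rcases eq_smul_cases hx hy h2 with h3 | h3
  · rw [h3, form_self hy] at h
    linarith
  · exact hxy h3

/-- If w separates the pair one way and v the other, every root px - qy with p, q ≥ 0 is made
positive by w and negative by v. There are infinitely many such roots, and their images under w all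
lie in the finite set N(w v⁻¹). -/
theorem below_or_below {x y : V} (hx : x ∈ G.roots) (hy : y ∈ G.roots) (h : 1 ≤ G.form x y) :
    G.Below x y ∨ G.Below y x := by
  by_contra! hcon
  simp only [Below, not_forall] at hcon
  obtain ⟨⟨w, hw1, hw2⟩, ⟨v, hv1, hv2⟩⟩ := hcon
  have hw2' := pos_of_not_neg (rep_mem_roots hx w) hw2
  have hv2' := pos_of_not_neg (rep_mem_roots hy v) hv2
  have hny := neg_mem_roots hy
  have hform : G.form x (-y) ≤ -1 := by
    rw [map_neg]
    linarith
  have hne : x ≠ - -y := by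
    rw [neg_neg]
    rintro rfl
    exact hw2 hw1
  have hfin := G.inversionSet_finite (w * v⁻¹)
  choose u p q hu hp hq hqp using exists_rep_eq_smul_add_smul hx hny hform
  have hmem : ∀ n, G.rep w (G.rep (u n) x) ∈ G.inversionSet (w * v⁻¹) := by
    intro n
    have hpn : 0 ≤ p n := (Nat.cast_nonneg n).trans (hp n)
    rw [mem_inversionSet]
    refine ⟨⟨rep_mem_roots (rep_mem_roots hx _) _, ?_⟩, ?_⟩
    · rw [hu, map_add, map_smul, map_smul, map_neg]
      exact ((inCone_of_pos hw2').smul hpn).add ((inCone_neg_of_neg hw1).smul (hq n))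
    · rw [mul_inv_rev, inv_inv, rep_mul_apply, rep_inv_apply_apply]
      refine ⟨neg_mem_roots (rep_mem_roots (rep_mem_roots hx _) _), ?_⟩
      have := ((inCone_neg_of_neg hv1).smul hpn).add ((inCone_of_pos hv2').smul (hq n))
      change G.InCone _
      rw [hu, map_add, map_smul, map_smul, map_neg]
      convert this using 1
      module
  have hpfin : (Set.range p).Finite := by
    have hr : (Set.range fun n => G.rep w (G.rep (u n) x)).Finite :=
      hfin.subset (Set.range_subset_iff.2 hmem)
    have := hr.to_subtype
    have hinj : ∀ m n, G.rep w (G.rep (u m) x) = G.rep w (G.rep (u n) x) → p m = p n := by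
      intro m n hmn
      have h1 := congrArg (G.rep w⁻¹) hmn
      rw [rep_inv_apply_apply, rep_inv_apply_apply, hu, hu] at h1
      exact smul_add_smul_injective hx hny hform hne h1
    choose f hf using fun z : Set.range fun n => G.rep w (G.rep (u n) x) => z.2
    refine (Set.finite_range fun z => p (f z)).subset ?_
    rintro _ ⟨n, rfl⟩
    exact ⟨⟨_, n, rfl⟩, hinj _ _ (hf ⟨_, n, rfl⟩)⟩
  obtain ⟨b, hb⟩ := hpfin.bddAbove
  obtain ⟨n, hn⟩ := exists_nat_gt b
  exact absurd (hb ⟨n, rfl⟩) (not_le.2 (hn.trans_le (hp n)))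

theorem neg_below_of_form_le {x y : V} (hx : x ∈ G.posRoots) (hy : y ∈ G.posRoots)
    (h : G.form x y ≤ -1) : G.Below (-x) y := by
  rcases below_or_below (neg_mem_roots hx.1) hy.1 (by
    rw [map_neg, LinearMap.neg_apply]
    linarith) with h1 | h1
  · exact h1
  · have := h1 1 (by simpa using neg_mem_negRoots hx)
    rw [map_one] at this
    exact absurd this (not_neg_of_pos hy)

/-! ### Behaviour of the infinite depth under reflections -/

variable (G) in
theorem mem_dom {x y : V} (hy : y ∈ G.posRoots) :
    x ∈ G.dom y ↔ x ∈ G.posRoots ∧ G.Below x y ∧ x ≠ y := by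
  constructor
  · rintro ⟨h1, h2, h3⟩
    exact ⟨h1, (dominated_iff_below h1 hy).1 h2, h3⟩
  · rintro ⟨h1, h2, h3⟩
    exact ⟨h1, (dominated_iff_below h1 hy).2 h2, h3⟩

theorem dom_finite {y : V} (hy : y ∈ G.posRoots) : (G.dom y).Finite := by
  refine (G.inversionSet_finite (G.reflection y)).subset fun x hx => hx.2.1 _ ?_
  rw [mem_inversionSet, reflection_inv hy.1, rep_reflection_self hy.1]
  exact ⟨hy, neg_mem_negRoots hy⟩

theorem infDepth_lt_of_below {x y : V} (hx : x ∈ G.posRoots) (hy : y ∈ G.posRoots)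
    (h : G.Below x y) (hxy : ¬ G.Below y x) : G.infDepth x < G.infDepth y := by
  refine (dom_finite hx).encard_lt_encard ((Set.ssubset_iff_of_subset ?_).2
    ⟨x, (G.mem_dom hy).2 ⟨hx, h, ?_⟩, fun h' => h'.2.2 rfl⟩)
  · intro z hz
    obtain ⟨h1, h2, -⟩ := (G.mem_dom hx).1 hz
    refine (G.mem_dom hy).2 ⟨h1, h2.trans h, ?_⟩
    rintro rfl
    exact hxy h2
  · rintro rfl
    exact hxy h

theorem rep_reflection_pos_of_form_nonpos {β γ : V} (hβ : β ∈ G.posRoots) (hγ : γ ∈ G.posRoots)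
    (h : G.form β γ ≤ 0) : G.rep (G.reflection β) γ ∈ G.posRoots := by
  refine pos_of_not_neg (rep_mem_roots hγ.1 _) fun hn => ?_
  have := form_pos_of_inversion hγ hβ hn
  linarith

/-- A root below `γ` that is inverted by `s_β` is also below `s_β γ`. -/
theorem Below.of_inversion {β γ x : V} (hβ : β ∈ G.posRoots)
    (h : G.form β γ ≤ 0) (hx : x ∈ G.posRoots) (hγ : γ ∈ G.posRoots) (hxγ : G.Below x γ)
    (hinv : G.rep (G.reflection β) x ∈ G.negRoots) :
    G.Below x (G.rep (G.reflection β) γ) := by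
  intro w hw
  by_contra hpos
  have hpos' := pos_of_not_neg (rep_mem_roots hx.1 w) hpos
  have hB := form_pos_of_inversion hx hβ hinv
  have h1 : G.rep (w * G.reflection β) x ∈ G.negRoots := hxγ _ (by rwa [rep_mul_apply])
  rw [rep_mul_apply, rep_reflection_apply hβ.1, map_sub, map_smul] at h1
  -- Here w s_β x is negative and equals wx - 2B(β,x)wβ with wx positive and B(β,x) > 0, which is
  -- impossible for negative wβ. Then wγ = w s_β γ + 2B(β,γ)wβ is negative as well.
  have hwβ : G.rep w β ∈ G.posRoots := by
    refine pos_of_not_neg (rep_mem_roots hβ.1 w) fun hn => not_neg_of_inCone ?_ h1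
    convert (inCone_of_pos hpos').add ((inCone_neg_of_neg hn).smul (c := 2 * G.form β x) (by linarith)) using 1
    module
  refine hpos (hxγ w ⟨neg_mem_roots (rep_mem_roots hγ.1 w), ?_⟩)
  rw [rep_reflection_apply hβ.1, map_sub, map_smul] at hw
  change G.InCone _
  convert (inCone_neg_of_neg hw).add ((inCone_of_pos hwβ).smul (c := -(2 * G.form β γ)) (by linarith)) using 1
  module

open Classical in
-- The map is s_β where this stays positive and the identity elsewhere. The two kinds of values
-- cannot collide: s_β takes a value of the first kind to a positive root and one of the second kind
-- to a negative root.
theorem exists_injOn_dom {β γ : V} (hβ : β ∈ G.posRoots) (hγ : γ ∈ G.posRoots)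
    (h : G.form β γ ≤ 0) : ∃ f : V → V, Set.InjOn f (G.dom γ) ∧
      Set.MapsTo f (G.dom γ) (G.dom (G.rep (G.reflection β) γ)) ∧
      ∀ x ∈ G.dom γ, f x = G.rep (G.reflection β) x ∨
        f x = x ∧ G.rep (G.reflection β) x ∈ G.negRoots := by
  have hδ := rep_reflection_pos_of_form_nonpos hβ hγ h
  refine ⟨fun x => if G.rep (G.reflection β) x ∈ G.posRoots then G.rep (G.reflection β) x else x,
    ?_, ?_, ?_⟩
  · intro x hx y hy hxy
    simp only at hxy
    split_ifs at hxy with h1 h2 h2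
    · have := congrArg (G.rep (G.reflection β)) hxy
      rwa [rep_reflection_reflection hβ.1, rep_reflection_reflection hβ.1] at this
    · rw [← hxy, rep_reflection_reflection hβ.1] at h2
      exact absurd hx.1 h2
    · rw [hxy, rep_reflection_reflection hβ.1] at h1
      exact absurd hy.1 h1
    · exact hxy
  · intro x hx
    obtain ⟨hx1, hx2, hx3⟩ := (G.mem_dom hγ).1 hx
    simp only
    split_ifs with h1
    · refine (G.mem_dom hδ).2 ⟨h1, hx2.rep _, fun he => hx3 ?_⟩
      have := congrArg (G.rep (G.reflection β)) he
      rwa [rep_reflection_reflection hβ.1, rep_reflection_reflection hβ.1] at this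
    · refine (G.mem_dom hδ).2 ⟨hx1, hx2.of_inversion hβ h hx1 hγ
        (neg_of_not_pos (rep_mem_roots hx1.1 _) h1), ?_⟩
      rintro rfl
      rw [rep_reflection_reflection hβ.1] at h1
      exact h1 hγ
  · intro x hx
    simp only
    split_ifs with h1
    · exact Or.inl rfl
    · exact Or.inr ⟨rfl, neg_of_not_pos (rep_mem_roots hx.1.1 _) h1⟩

theorem infDepth_le_reflection {β γ : V} (hβ : β ∈ G.posRoots) (hγ : γ ∈ G.posRoots)
    (h : G.form β γ ≤ 0) : G.infDepth γ ≤ G.infDepth (G.rep (G.reflection β) γ) := by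
  obtain ⟨f, hf, hf', -⟩ := exists_injOn_dom hβ hγ h
  exact Set.encard_le_encard_of_injOn hf' hf

/-- Applying s_β to -β ⪯ γ puts β in Dom(s_β γ). The injection misses β: a preimage would be -β,
which is not positive, or β itself, which is not below γ. -/
theorem infDepth_lt_reflection {β γ : V} (hβ : β ∈ G.posRoots) (hγ : γ ∈ G.posRoots)
    (h : G.form β γ ≤ 0) (hβγ : G.Below (-β) γ) :
    G.infDepth γ < G.infDepth (G.rep (G.reflection β) γ) := by
  obtain ⟨f, hf, hf', hf''⟩ := exists_injOn_dom hβ hγ h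
  have hδ := rep_reflection_pos_of_form_nonpos hβ hγ h
  have hβδ : G.Below β (G.rep (G.reflection β) γ) := by
    have := hβγ.rep (G.reflection β)
    rwa [map_neg, rep_reflection_self hβ.1, neg_neg] at this
  have hnot := not_below_of_neg_below hγ hβγ
  rw [infDepth, infDepth, ← hf.encard_image]
  refine ((dom_finite hγ).image f).encard_lt_encard ((Set.ssubset_iff_of_subset hf'.image_subset).2
    ⟨β, (G.mem_dom hδ).2 ⟨hβ, hβδ, fun he => ?_⟩, ?_⟩)
  · have h1 : G.rep (G.reflection β) β = γ := by
      have := congrArg (G.rep (G.reflection β)) he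
      rwa [rep_reflection_reflection hβ.1] at this
    rw [rep_reflection_self hβ.1] at h1
    exact not_pos_of_neg (neg_mem_negRoots hβ) (h1 ▸ hγ)
  · rintro ⟨x, hx, hxβ⟩
    rcases hf'' x hx with h1 | ⟨h1, -⟩
    · have h2 := congrArg (G.rep (G.reflection β)) (h1.symm.trans hxβ)
      rw [rep_reflection_reflection hβ.1, rep_reflection_self hβ.1] at h2
      exact not_pos_of_neg (neg_mem_negRoots hβ) (h2 ▸ hx.1)
    · have h2 : x = β := h1.symm.trans hxβ
      subst h2
      exact hnot ((G.mem_dom hγ).1 hx).2.1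

end GeomRep

namespace GeomRep

variable {ι W : Type*} [Fintype ι] [Group W] {M : CoxeterMatrix ι} {cs : CoxeterSystem M W}
  {V : Type*} [AddCommGroup V] [Module ℝ V] {G : GeomRep cs V} {W' : Subgroup W}

/-! ### Canonical simple roots of a reflection subgroup -/

theorem rep_mem_subRoots {β : V} (hβ : β ∈ G.subRoots W') {x : W} (hx : x ∈ W') :
    G.rep x β ∈ G.subRoots W' := by
  refine ⟨rep_mem_roots hβ.1 x, ?_⟩
  rw [reflection_rep hβ.1]
  exact W'.mul_mem (W'.mul_mem hx hβ.2) (W'.inv_mem hx)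

theorem mem_canonicalSimpleRoots {α : V} :
    α ∈ G.canonicalSimpleRoots W' ↔ α ∈ G.subPosRoots W' ∧
      ∀ x ∈ G.subPosRoots W', G.rep (G.reflection α) x ∈ G.negRoots → x = α := by
  constructor
  · rintro ⟨hα, h⟩
    have h1 : α ∈ G.inversionSet (G.reflection α) ∩ G.subRoots W' := h ▸ rfl
    refine ⟨⟨h1.2, hα⟩, fun x hx hneg => ?_⟩
    have h2 : x ∈ G.inversionSet (G.reflection α) ∩ G.subRoots W' :=
      ⟨mem_inversionSet.2 ⟨hx.2, by rwa [reflection_inv hα.1]⟩, hx.1⟩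
    rwa [h] at h2
  · rintro ⟨hα, h⟩
    refine ⟨hα.2, Set.eq_singleton_iff_unique_mem.2 ⟨⟨mem_inversionSet.2 ⟨hα.2, ?_⟩, hα.1⟩, ?_⟩⟩
    · rw [reflection_inv hα.1.1, rep_reflection_self hα.1.1]
      exact neg_mem_negRoots hα.2
    · rintro x ⟨hx1, hx2⟩
      rw [mem_inversionSet, reflection_inv hα.1.1] at hx1
      exact h x ⟨hx2, hx1.1⟩ hx1.2

theorem canonicalSimpleRoots_subset : G.canonicalSimpleRoots W' ⊆ G.subPosRoots W' :=
  fun _ h => (mem_canonicalSimpleRoots.1 h).1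

theorem reflection_mem_canonicalReflections {α : V} (hα : α ∈ G.canonicalSimpleRoots W') :
    G.reflection α ∈ G.canonicalReflections W' := ⟨α, hα, rfl⟩

theorem canonicalReflections_subset : G.canonicalReflections W' ⊆ W' := by
  rintro _ ⟨α, hα, rfl⟩
  exact (canonicalSimpleRoots_subset hα).1.2

theorem rep_canonical_pos {α x : V} (hα : α ∈ G.canonicalSimpleRoots W')
    (hx : x ∈ G.subPosRoots W') (hne : x ≠ α) : G.rep (G.reflection α) x ∈ G.subPosRoots W' :=
  ⟨rep_mem_subRoots hx.1 (canonicalSimpleRoots_subset hα).1.2,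
    pos_of_not_neg (rep_mem_roots hx.2.1 _) fun h => hne ((mem_canonicalSimpleRoots.1 hα).2 x hx h)⟩

theorem form_nonpos_of_rep_pos {β γ : V} (hβ : β ∈ G.canonicalSimpleRoots W')
    (hγ : γ ∈ G.subPosRoots W') (hne : γ ≠ β) (h : G.rep (G.reflection γ) β ∈ G.posRoots) :
    G.form β γ ≤ 0 := by
  by_contra! hB
  have hβ' := canonicalSimpleRoots_subset hβ
  have hdec : G.rep (G.reflection γ) β = β - (2 * G.form β γ) • γ := by
    rw [rep_reflection_apply hγ.2.1, G.form_symm]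
  have hne' : G.rep (G.reflection γ) β ≠ β := by
    rw [hdec]
    intro he
    rw [sub_eq_self, smul_eq_zero] at he
    rcases he with he | he
    · linarith
    · exact ne_zero_of_mem_roots hγ.2.1 he
  have h1 := rep_canonical_pos hβ ⟨rep_mem_subRoots hβ'.1 hγ.1.2, h⟩ hne'
  have h2 := rep_canonical_pos hβ hγ hne
  -- Since s_β keeps positive every positive root of W' other than β, the identity -β = s_β s_γ β +
  -- 2B(β,γ) s_β γ would place -β in the cone.
  refine not_neg_of_inCone ?_ (neg_mem_negRoots hβ'.2)
  convert (inCone_of_pos h1.2).add ((inCone_of_pos h2.2).smul (c := 2 * G.form β γ)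
    (by linarith)) using 1
  rw [hdec, map_sub, map_smul, rep_reflection_self hβ'.1.1]
  module

theorem form_canonical_nonpos {α β : V} (hα : α ∈ G.canonicalSimpleRoots W')
    (hβ : β ∈ G.canonicalSimpleRoots W') (hne : α ≠ β) : G.form α β ≤ 0 :=
  form_nonpos_of_rep_pos hα (canonicalSimpleRoots_subset hβ) hne.symm
    (rep_canonical_pos hβ (canonicalSimpleRoots_subset hα) hne).2

/-- The exchange condition for canonical reflections. -/
theorem exists_word_mul_reflection {α : V} (hα : α ∈ G.canonicalSimpleRoots W') (l : List W)
    (hl : ∀ x ∈ l, x ∈ G.canonicalReflections W') (hneg : G.rep l.prod α ∈ G.negRoots) :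
    ∃ l' : List W, (∀ x ∈ l', x ∈ G.canonicalReflections W') ∧
      l'.prod = l.prod * G.reflection α ∧ l'.length + 1 = l.length := by
  have hα' := canonicalSimpleRoots_subset hα
  induction l with
  | nil => exact absurd (by simpa using hneg) (not_neg_of_pos hα'.2)
  | cons x l ih =>
    have hl' : ∀ x ∈ l, x ∈ G.canonicalReflections W' := fun y hy => hl y (List.mem_cons_of_mem _ hy)
    by_cases h : G.rep l.prod α ∈ G.negRoots
    · obtain ⟨l', h1, h2, h3⟩ := ih hl' h
      refine ⟨x :: l', ?_, by rw [List.prod_cons, h2, List.prod_cons, mul_assoc],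
        by simpa using h3⟩
      intro y hy
      rcases List.mem_cons.1 hy with rfl | hy
      · exact hl _ List.mem_cons_self
      · exact h1 y hy
    · obtain ⟨β, hβ, rfl⟩ := hl x List.mem_cons_self
      have hmem : l.prod ∈ W' :=
        Subgroup.list_prod_mem _ fun y hy => canonicalReflections_subset (hl' y hy)
      have hsub : G.rep l.prod α ∈ G.subPosRoots W' :=
        ⟨rep_mem_subRoots hα'.1 hmem, pos_of_not_neg (rep_mem_roots hα'.2.1 _) h⟩
      rw [List.prod_cons, rep_mul_apply] at hneg
      have heq := (mem_canonicalSimpleRoots.1 hβ).2 _ hsub hneg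
      refine ⟨l, hl', ?_, rfl⟩
      rw [List.prod_cons, ← heq, reflection_rep hα'.2.1]
      simp [mul_assoc, reflection_mul_self hα'.2.1]

/-! ### The length function of a reflection subgroup -/

theorem subLength_le {l : List W} (hl : ∀ x ∈ l, x ∈ G.canonicalReflections W') :
    G.subLength W' l.prod ≤ l.length := Nat.sInf_le ⟨l, hl, rfl, rfl⟩

variable (G W') in
/-- `W'` is generated by its canonical reflections. -/
def CanonicallyGenerated : Prop := W' ≤ Subgroup.closure (G.canonicalReflections W')

theorem exists_word (hgen : G.CanonicallyGenerated W') {w : W} (hw : w ∈ W') :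
    ∃ l : List W, (∀ x ∈ l, x ∈ G.canonicalReflections W') ∧ l.prod = w := by
  have hw' := hgen hw
  rw [← Subgroup.mem_toSubmonoid, Subgroup.closure_toSubmonoid] at hw'
  obtain ⟨l, hl, hlw⟩ := Submonoid.exists_list_of_mem_closure hw'
  refine ⟨l, fun x hx => ?_, hlw⟩
  rcases hl x hx with h | h
  · exact h
  · obtain ⟨α, hα, hαx⟩ := h
    rw [← inv_inv x, ← hαx, reflection_inv (canonicalSimpleRoots_subset hα).2.1]
    exact ⟨α, hα, rfl⟩

theorem exists_word_length (hgen : G.CanonicallyGenerated W') {w : W} (hw : w ∈ W') :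
    ∃ l : List W, (∀ x ∈ l, x ∈ G.canonicalReflections W') ∧ l.prod = w ∧
      l.length = G.subLength W' w := by
  obtain ⟨l, hl, hlw⟩ := exists_word hgen hw
  exact Nat.sInf_mem (s := {n | ∃ l : List W, (∀ x ∈ l, x ∈ G.canonicalReflections W') ∧
    l.prod = w ∧ l.length = n}) ⟨_, l, hl, hlw, rfl⟩

theorem subLength_mul_le (hgen : G.CanonicallyGenerated W') {w v : W} (hw : w ∈ W')
    (hv : v ∈ W') : G.subLength W' (w * v) ≤ G.subLength W' w + G.subLength W' v := by
  obtain ⟨l, hl, rfl, h⟩ := exists_word_length hgen hw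
  obtain ⟨k, hk, rfl, h'⟩ := exists_word_length hgen hv
  rw [← h, ← h', ← List.prod_append, ← List.length_append]
  refine subLength_le fun x hx => ?_
  rcases List.mem_append.1 hx with hx | hx
  · exact hl x hx
  · exact hk x hx

theorem subLength_reflection_le {α : V} (hα : α ∈ G.canonicalSimpleRoots W') :
    G.subLength W' (G.reflection α) ≤ 1 := by
  have := subLength_le (G := G) (W' := W') (l := [G.reflection α]) (by
    simpa using reflection_mem_canonicalReflections hα)
  simpa using this

theorem subLength_mul_reflection_lt (hgen : G.CanonicallyGenerated W') {w : W} (hw : w ∈ W')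
    {α : V} (hα : α ∈ G.canonicalSimpleRoots W') (h : G.rep w α ∈ G.negRoots) :
    G.subLength W' (w * G.reflection α) < G.subLength W' w := by
  obtain ⟨l, hl, rfl, h'⟩ := exists_word_length hgen hw
  obtain ⟨k, hk, hk', hlen⟩ := exists_word_mul_reflection hα l hl h
  have := subLength_le hk
  rw [hk'] at this
  omega

theorem subLength_reflection_rep_le (hgen : G.CanonicallyGenerated W') {γ : V}
    (hγ : γ ∈ G.subRoots W') {β : V}
    (hβ : β ∈ G.canonicalSimpleRoots W') :
    G.subLength W' (G.reflection (G.rep (G.reflection β) γ)) ≤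
      G.subLength W' (G.reflection γ) + 2 := by
  have hβ' := canonicalSimpleRoots_subset hβ
  rw [reflection_rep hγ.1, reflection_inv hβ'.2.1]
  have h1 := subLength_mul_le hgen (W'.mul_mem hβ'.1.2 hγ.2) hβ'.1.2
  have h2 := subLength_mul_le hgen hβ'.1.2 hγ.2
  have h3 := subLength_reflection_le hβ
  omega

/-- If s_γ β were negative, s_γ s_β would be shorter than s_γ, and the conjugate s_β s_γ s_β could
not gain 2. -/
theorem form_nonpos_of_subLength (hgen : G.CanonicallyGenerated W') {β γ : V}
    (hβ : β ∈ G.canonicalSimpleRoots W') (hγ : γ ∈ G.subPosRoots W')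
    (h : G.subLength W' (G.reflection γ) + 2 ≤
      G.subLength W' (G.reflection (G.rep (G.reflection β) γ))) : G.form β γ ≤ 0 := by
  have hβ' := canonicalSimpleRoots_subset hβ
  rw [reflection_rep hγ.1.1, reflection_inv hβ'.2.1] at h
  refine form_nonpos_of_rep_pos hβ hγ ?_ (pos_of_not_neg (rep_mem_roots hβ'.2.1 _) fun hneg => ?_)
  · rintro rfl
    rw [reflection_mul_self hγ.1.1, one_mul] at h
    omega
  · have h1 := subLength_mul_reflection_lt hgen hγ.1.2 hβ hneg
    have h2 := subLength_mul_le hgen hβ'.1.2 (W'.mul_mem hγ.1.2 hβ'.1.2)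
    have h3 := subLength_reflection_le hβ
    rw [← mul_assoc] at h2
    omega

/-- The upper bound is carried along in the induction because it turns equality for the whole word
into equality at every letter. -/
theorem infDepth_le_of_word (hgen : G.CanonicallyGenerated W') {γ : V}
    (hγ : γ ∈ G.subPosRoots W') (l : List W) (hl : ∀ x ∈ l, x ∈ G.canonicalReflections W') :
    G.subLength W' (G.reflection (G.rep l.prod γ)) ≤
        G.subLength W' (G.reflection γ) + 2 * l.length ∧
      (G.subLength W' (G.reflection (G.rep l.prod γ)) =
          G.subLength W' (G.reflection γ) + 2 * l.length →
        G.rep l.prod γ ∈ G.posRoots ∧ G.infDepth γ ≤ G.infDepth (G.rep l.prod γ)) := by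
  induction l with
  | nil => simpa using hγ.2
  | cons x l ih =>
    have hl' : ∀ x ∈ l, x ∈ G.canonicalReflections W' := fun y hy => hl y (List.mem_cons_of_mem _ hy)
    obtain ⟨β, hβ, rfl⟩ := hl x List.mem_cons_self
    obtain ⟨ih1, ih2⟩ := ih hl'
    have hmem : l.prod ∈ W' :=
      Subgroup.list_prod_mem _ fun y hy => canonicalReflections_subset (hl' y hy)
    have hsub := rep_mem_subRoots hγ.1 hmem
    have h1 := subLength_reflection_rep_le hgen hsub hβ
    rw [List.prod_cons, rep_mul_apply, List.length_cons]
    refine ⟨by omega, fun h => ?_⟩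
    obtain ⟨hpos, hle⟩ := ih2 (by omega)
    have hB := form_nonpos_of_subLength hgen hβ ⟨hsub, hpos⟩ (by omega)
    have hβpos := (canonicalSimpleRoots_subset hβ).2
    exact ⟨rep_reflection_pos_of_form_nonpos hβpos hpos hB,
      hle.trans (infDepth_le_reflection hβpos hpos hB)⟩

/-! ### Reflection subgroups are generated by their canonical reflections -/

/-- The map s_i permutes the positive roots other than α_i, and α_i belongs to neither W' nor its
conjugate by s_i. So s_i matches their positive roots, and with them their canonical simple roots.
-/
theorem rep_simple_mem_canonicalSimpleRoots {i : ι} (hi : cs.simple i ∉ W') {α : V}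
    (hα : α ∈ G.canonicalSimpleRoots (W'.comap (MulAut.conj (cs.simple i)).toMonoidHom)) :
    G.rep (cs.simple i) α ∈ G.canonicalSimpleRoots W' := by
  have hmem : ∀ x, x ∈ W'.comap (MulAut.conj (cs.simple i)).toMonoidHom ↔
      cs.simple i * x * cs.simple i ∈ W' := fun x => by simp
  have hi' : cs.simple i ∉ W'.comap (MulAut.conj (cs.simple i)).toMonoidHom := by
    rw [hmem]
    simpa using hi
  obtain ⟨⟨⟨hα1, hα2⟩, hα3⟩, hα4⟩ := mem_canonicalSimpleRoots.1 hα
  have href : ∀ {x : V}, x ∈ G.roots → G.reflection (G.rep (cs.simple i) x) =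
      cs.simple i * G.reflection x * cs.simple i := fun hx => by
    rw [reflection_rep hx, cs.inv_simple]
  have hss : ∀ v, G.rep (cs.simple i) (G.rep (cs.simple i) v) = v := fun v => by
    rw [← rep_mul_apply, cs.simple_mul_simple_self]
    simp
  have hne : ∀ {U : Subgroup W}, cs.simple i ∉ U → ∀ {x}, x ∈ G.subRoots U →
      x ≠ G.simpleRoot i := by
    rintro U hU x hx rfl
    exact hU (by simpa [G.reflection_simpleRoot] using hx.2)
  refine mem_canonicalSimpleRoots.2 ⟨⟨⟨rep_mem_roots hα1 _, ?_⟩,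
    G.rep_simple_pos hα3 (hne hi' ⟨hα1, hα2⟩)⟩, ?_⟩
  · rw [href hα1]
    exact (hmem _).1 hα2
  · intro x hx hneg
    have hy : G.rep (cs.simple i) x ∈
        G.subRoots (W'.comap (MulAut.conj (cs.simple i)).toMonoidHom) := by
      refine ⟨rep_mem_roots hx.2.1 _, ?_⟩
      rw [hmem, href hx.2.1]
      simpa [mul_assoc] using hx.1.2
    have hy' := G.rep_simple_pos hx.2 (hne hi hx.1)
    rw [href hα1, rep_mul_apply, rep_mul_apply] at hneg
    have hz := rep_mem_subRoots hy hα2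
    have := hα4 _ ⟨hy, hy'⟩ (neg_of_not_pos hz.1 fun hzpos =>
      not_neg_of_pos (G.rep_simple_pos hzpos (hne hi' hz)) hneg)
    rw [← this, hss]

theorem simple_mem_canonicalReflections {i : ι} (hi : cs.simple i ∈ W') :
    cs.simple i ∈ G.canonicalReflections W' := by
  refine ⟨G.simpleRoot i, mem_canonicalSimpleRoots.2 ⟨⟨⟨G.simpleRoot_mem_roots i, ?_⟩,
    G.simpleRoot_mem_posRoots i⟩, fun x hx hneg => ?_⟩, G.reflection_simpleRoot i⟩
  · rwa [G.reflection_simpleRoot]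
  · by_contra hne
    rw [G.reflection_simpleRoot] at hneg
    exact not_neg_of_pos (G.rep_simple_pos hx.2 hne) hneg

variable (G) in
-- The subgroup is quantified inside the induction: when the first letter s_i lies in W' it is
-- canonical and can be stripped off, and otherwise W' is replaced by its conjugate by s_i.
theorem conj_simple_mem_closure (l : List ι) (j : ι) : ∀ W' : Subgroup W,
    cs.wordProd l * cs.simple j * (cs.wordProd l)⁻¹ ∈ W' →
    cs.wordProd l * cs.simple j * (cs.wordProd l)⁻¹ ∈
      Subgroup.closure (G.canonicalReflections W') := by
  induction l with
  | nil =>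
    intro W' h
    simp only [CoxeterSystem.wordProd_nil, one_mul, inv_one, mul_one] at h ⊢
    exact Subgroup.subset_closure (simple_mem_canonicalReflections h)
  | cons i l ih =>
    intro W' h
    set t := cs.wordProd l * cs.simple j * (cs.wordProd l)⁻¹ with ht
    have hconj : cs.wordProd (i :: l) * cs.simple j * (cs.wordProd (i :: l))⁻¹ =
        cs.simple i * t * cs.simple i := by
      rw [cs.wordProd_cons, mul_inv_rev, cs.inv_simple, ht]
      simp only [mul_assoc]
    rw [hconj] at h ⊢
    by_cases hi : cs.simple i ∈ W'
    · have hi' : cs.simple i ∈ Subgroup.closure (G.canonicalReflections W') :=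
        Subgroup.subset_closure (simple_mem_canonicalReflections hi)
      refine Subgroup.mul_mem _ (Subgroup.mul_mem _ hi' (ih W' ?_)) hi'
      simpa [mul_assoc] using W'.mul_mem (W'.mul_mem hi h) hi
    · have h1 := ih (W'.comap (MulAut.conj (cs.simple i)).toMonoidHom) (by simpa using h)
      have h2 : Subgroup.closure (G.canonicalReflections
          (W'.comap (MulAut.conj (cs.simple i)).toMonoidHom)) ≤
          (Subgroup.closure (G.canonicalReflections W')).comap
            (MulAut.conj (cs.simple i)).toMonoidHom := by
        rw [Subgroup.closure_le]
        rintro _ ⟨α, hα, rfl⟩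
        refine Subgroup.subset_closure ⟨_, rep_simple_mem_canonicalSimpleRoots hi hα, ?_⟩
        rw [reflection_rep (canonicalSimpleRoots_subset hα).2.1]
        rfl
      simpa using h2 h1

theorem canonicallyGenerated_of_closure {R : Set V} (hR : R ⊆ G.roots)
    (hW' : W' = Subgroup.closure (G.reflection '' R)) : G.CanonicallyGenerated W' := by
  rw [CanonicallyGenerated]
  conv_lhs => rw [hW']
  rw [Subgroup.closure_le]
  rintro _ ⟨β, hβ, rfl⟩
  have hmem : G.reflection β ∈ W' := hW' ▸ Subgroup.subset_closure ⟨β, hβ, rfl⟩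
  obtain ⟨w, i, hw⟩ := hR hβ
  obtain ⟨l, rfl⟩ := cs.wordProd_surjective w
  rw [hw, reflection_rep (G.simpleRoot_mem_roots i), G.reflection_simpleRoot] at hmem ⊢
  exact G.conj_simple_mem_closure l i W' hmem

end GeomRep

/-- Normal form of a word in two involutions `σ`, `τ`. -/
theorem exists_zpow_of_word {W : Type*} [Group W] {σ τ : W} (hσ : σ * σ = 1) (hτ : τ * τ = 1)
    (l : List W) (hl : ∀ x ∈ l, x = σ ∨ x = τ) :
    ∃ i : ℤ, (l.prod = (σ * τ) ^ i ∧ 2 * |i| ≤ l.length) ∨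
      (l.prod = (σ * τ) ^ i * σ ∧ |2 * i + 1| ≤ l.length) := by
  have hσ' : σ⁻¹ = σ := inv_eq_of_mul_eq_one_right hσ
  have hτ' : τ⁻¹ = τ := inv_eq_of_mul_eq_one_right hτ
  have hconj : ∀ i : ℤ, σ * (σ * τ) ^ i = (σ * τ) ^ (-i) * σ := by
    intro i
    have h1 : σ * (σ * τ) ^ i * σ⁻¹ = (σ * (σ * τ) * σ⁻¹) ^ i := conj_zpow.symm
    have h2 : σ * (σ * τ) * σ⁻¹ = (σ * τ)⁻¹ := by
      rw [mul_inv_rev, hσ', hτ', ← mul_assoc, hσ, one_mul]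
    rw [h2, inv_zpow, ← zpow_neg, mul_inv_eq_iff_eq_mul] at h1
    exact h1
  have hτσ : τ = (σ * τ) ^ (-1 : ℤ) * σ := by
    rw [zpow_neg_one, mul_inv_rev, hσ', hτ', mul_assoc, hσ, mul_one]
  have hconj' : ∀ i : ℤ, τ * (σ * τ) ^ i = (σ * τ) ^ (-1 - i) * σ := by
    intro i
    rw [congrArg (· * (σ * τ) ^ i) hτσ, mul_assoc, hconj, ← mul_assoc, ← zpow_add,
      sub_eq_add_neg]
  induction l with
  | nil => exact ⟨0, Or.inl (by simp)⟩
  | cons x l ih =>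
    obtain ⟨i, h⟩ := ih fun y hy => hl y (List.mem_cons_of_mem _ hy)
    rw [List.prod_cons, List.length_cons]
    push_cast
    rcases hl x List.mem_cons_self with rfl | rfl <;> rcases h with ⟨h, h'⟩ | ⟨h, h'⟩
    · exact ⟨-i, Or.inr ⟨by rw [h, hconj], by grind⟩⟩
    · exact ⟨-i, Or.inl ⟨by rw [h, ← mul_assoc, hconj, mul_assoc, hσ, mul_one], by grind⟩⟩
    · exact ⟨-1 - i, Or.inr ⟨by rw [h, hconj'], by grind⟩⟩
    · exact ⟨-1 - i, Or.inl ⟨by rw [h, ← mul_assoc, hconj', mul_assoc, hσ, mul_one], by grind⟩⟩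

namespace GeomRep

variable {ι W : Type*} [Fintype ι] [Group W] {M : CoxeterMatrix ι} {cs : CoxeterSystem M W}
  {V : Type*} [AddCommGroup V] [Module ℝ V] {G : GeomRep cs V} {W' : Subgroup W}

/-! ### Chains of roots in an infinite dihedral reflection subgroup -/

variable (G) in
/-- The roots `α, s_α β, s_α s_β α, …`. -/
noncomputable def rootChain : ℕ → V → V → V
  | 0, α, _ => α
  | n + 1, α, β => G.rep (G.reflection α) (rootChain n β α)

theorem rootChain_mem_roots {α β : V} (hα : α ∈ G.roots) (hβ : β ∈ G.roots) (n : ℕ) :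
    G.rootChain n α β ∈ G.roots := by
  induction n generalizing α β with
  | zero => exact hα
  | succ n ih => exact rep_mem_roots (ih hβ hα) _

theorem reflection_rootChain {α β : V} (hα : α ∈ G.roots) (hβ : β ∈ G.roots) (n : ℕ) :
    G.reflection (G.rootChain n α β) =
      (G.reflection α * G.reflection β) ^ n * G.reflection α := by
  induction n generalizing α β with
  | zero => simp [rootChain]
  | succ n ih =>
    rw [rootChain, reflection_rep (rootChain_mem_roots hβ hα n), ih hβ hα, reflection_inv hα,
      ← mul_assoc, ← mul_pow_mul, mul_assoc, pow_succ]
    simp only [mul_assoc]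

theorem rootChain_below_succ {α β : V} (hα : α ∈ G.posRoots) (hβ : β ∈ G.posRoots)
    (h : G.form α β ≤ -1) (n : ℕ) :
    G.Below (G.rootChain n α β) (G.rootChain (n + 1) α β) ∧
      ¬ G.Below (G.rootChain (n + 1) α β) (G.rootChain n α β) := by
  have h' : G.form β α ≤ -1 := by rwa [G.form_symm]
  induction n generalizing α β with
  | zero =>
    simp only [rootChain]
    constructor
    -- Apply s_α to -β ⪯ α, then negate, to get α ⪯ s_α β.
    · have h1 := (neg_below_of_form_le hβ hα h').rep (G.reflection α)
      rw [rep_reflection_self hα.1] at h1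
      simpa using h1.neg (neg_mem_roots hα.1)
    · intro h1
      have h2 := h1.rep (G.reflection α)
      rw [rep_reflection_reflection hα.1, rep_reflection_self hα.1] at h2
      have h3 := h2 1 (by simpa using neg_mem_negRoots hα)
      rw [map_one] at h3
      exact not_neg_of_pos hβ h3
  | succ n ih =>
    obtain ⟨ih1, ih2⟩ := ih hβ hα h' h
    refine ⟨ih1.rep (G.reflection α), fun hb => ih2 ?_⟩
    have h1 : G.Below (G.rep _ (G.rep (G.reflection α) (G.rootChain (n + 1) β α)))
      (G.rep _ (G.rep (G.reflection α) (G.rootChain n β α))) := hb.rep (G.reflection α)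
    rwa [rep_reflection_reflection hα.1, rep_reflection_reflection hα.1] at h1

theorem below_rootChain {α β : V} (hα : α ∈ G.posRoots) (hβ : β ∈ G.posRoots)
    (h : G.form α β ≤ -1) (n : ℕ) : G.Below α (G.rootChain n α β) := by
  induction n with
  | zero => exact fun w hw => hw
  | succ n ih => exact ih.trans (rootChain_below_succ hα hβ h n).1

theorem rootChain_pos {α β : V} (hα : α ∈ G.posRoots) (hβ : β ∈ G.posRoots)
    (h : G.form α β ≤ -1) (n : ℕ) : G.rootChain n α β ∈ G.posRoots :=
  (below_rootChain hα hβ h n).pos hα (rootChain_mem_roots hα.1 hβ.1 n)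

theorem infDepth_rootChain_lt_succ {α β : V} (hα : α ∈ G.posRoots) (hβ : β ∈ G.posRoots)
    (h : G.form α β ≤ -1) (n : ℕ) :
    G.infDepth (G.rootChain n α β) < G.infDepth (G.rootChain (n + 1) α β) ∧
      G.infDepth (G.rootChain n α β) < G.infDepth (G.rootChain (n + 1) β α) := by
  have h' : G.form β α ≤ -1 := by rwa [G.form_symm]
  have hpos := rootChain_pos hα hβ h n
  obtain ⟨h1, h2⟩ := rootChain_below_succ hα hβ h n
  refine ⟨infDepth_lt_of_below hpos (rootChain_pos hα hβ h _) h1 h2,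
    infDepth_lt_reflection hβ hpos ?_
      ((neg_below_of_form_le hβ hα h').trans (below_rootChain hα hβ h n))⟩
  -- The required sign of B(β,γ), for γ the current root, comes from β ⪯ s_β γ: dominance forces
  -- B(s_β γ, β) > 0, and s_β preserves the form.
  have h3 := (below_rootChain hβ hα h' (n + 1)).form_pos hβ (rootChain_pos hβ hα h' _)
  have h4 := G.rep_form (G.reflection β) (G.rootChain n α β) (-β)
  rw [map_neg, rep_reflection_self hβ.1, neg_neg] at h4
  rw [rootChain, h4, map_neg, G.form_symm] at h3
  linarith

theorem infDepth_rootChain_lt {α β : V} (hα : α ∈ G.posRoots) (hβ : β ∈ G.posRoots)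
    (h : G.form α β ≤ -1) {m n : ℕ} (hmn : m < n) :
    G.infDepth (G.rootChain m α β) < G.infDepth (G.rootChain n α β) ∧
      G.infDepth (G.rootChain m α β) < G.infDepth (G.rootChain n β α) := by
  have h' : G.form β α ≤ -1 := by rwa [G.form_symm]
  induction n, hmn using Nat.le_induction with
  | base => exact infDepth_rootChain_lt_succ hα hβ h m
  | succ n _ ih =>
    exact ⟨ih.1.trans (infDepth_rootChain_lt_succ hα hβ h n).1,
      ih.2.trans (infDepth_rootChain_lt_succ hβ hα h' n).1⟩

/-! ### Canonical simple roots of a dihedral reflection subgroup -/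

theorem inCone_relation {α β γ : V} (hα : α ∈ G.posRoots) (hβ : β ∈ G.posRoots)
    (hγ : γ ∈ G.posRoots) {p q r : ℝ} (hp : 0 ≤ p) (hq : 0 ≤ q) (hr : 0 ≤ r)
    (h : p • α + q • β + r • γ = 0) : p = 0 := by
  have h1 : p • α = 0 := ((inCone_of_pos hα).smul hp).eq_zero (by
    convert ((inCone_of_pos hβ).smul hq).add ((inCone_of_pos hγ).smul hr) using 1
    rw [neg_eq_iff_add_eq_zero, ← h, add_assoc])
  exact (smul_eq_zero.1 h1).resolve_right (ne_zero_of_mem_roots hα.1)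

theorem relation_of_nonneg {α β γ : V} (hα : α ∈ G.posRoots) (hβ : β ∈ G.posRoots)
    (hγ : γ ∈ G.posRoots) (h1 : G.form α γ ≤ 0) (h2 : G.form β γ ≤ 0) {p q r : ℝ}
    (hp : 0 ≤ p) (hq : 0 ≤ q) (h : p • α + q • β + r • γ = 0) : p = 0 ∧ q = 0 ∧ r = 0 := by
  have hr : 0 ≤ r := by
    have h3 := congrArg (G.form γ) h
    simp only [map_add, map_smul, smul_eq_mul, map_zero] at h3
    rw [form_self hγ.1, G.form_symm γ α, G.form_symm γ β] at h3
    nlinarith [mul_nonneg hp (neg_nonneg.2 h1), mul_nonneg hq (neg_nonneg.2 h2)]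
  refine ⟨inCone_relation hα hβ hγ hp hq hr h, inCone_relation hβ hα hγ hq hp hr ?_,
    inCone_relation hγ hα hβ hr hp hq ?_⟩ <;> rw [← h] <;> abel

/-- Linear independence of three positive roots with pairwise nonpositive products. Up to a global
sign two coefficients are nonnegative; pairing with the third root makes its coefficient nonnegative
too, and the cone contains no line. -/
theorem relation_of_form_nonpos {α β γ : V} (hα : α ∈ G.posRoots) (hβ : β ∈ G.posRoots)
    (hγ : γ ∈ G.posRoots) (h1 : G.form α β ≤ 0) (h2 : G.form α γ ≤ 0) (h3 : G.form β γ ≤ 0)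
    {p q r : ℝ} (h : p • α + q • β + r • γ = 0) : p = 0 ∧ q = 0 ∧ r = 0 := by
  wlog hp : 0 ≤ p generalizing p q r
  · obtain ⟨e1, e2, e3⟩ := this (p := -p) (q := -q) (r := -r) (by
      rw [← neg_eq_zero, ← h]
      module) (by linarith)
    exact ⟨neg_eq_zero.1 e1, neg_eq_zero.1 e2, neg_eq_zero.1 e3⟩
  by_cases hq : 0 ≤ q
  · exact relation_of_nonneg hα hβ hγ h2 h3 hp hq h
  by_cases hr : 0 ≤ r
  · obtain ⟨e1, e2, e3⟩ := relation_of_nonneg (r := q) hα hγ hβ h1 (by rwa [G.form_symm]) hp hr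
      (by rw [← h]; abel)
    exact ⟨e1, e3, e2⟩
  · obtain ⟨e1, e2, e3⟩ := relation_of_nonneg (p := -q) (q := -r) (r := -p) hβ hγ hα
      (by rwa [G.form_symm]) (by rwa [G.form_symm]) (by linarith) (by linarith)
      (by rw [← neg_eq_zero, ← h]; module)
    exact ⟨neg_eq_zero.1 e3, neg_eq_zero.1 e1, neg_eq_zero.1 e2⟩

theorem rep_sub_mem_span {a b : V} (ha : a ∈ G.roots) (hb : b ∈ G.roots) {w : W}
    (hw : w ∈ Subgroup.closure {G.reflection a, G.reflection b}) (v : V) :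
    G.rep w v - v ∈ Submodule.span ℝ {a, b} := by
  induction hw using Subgroup.closure_induction generalizing v with
  | mem x hx =>
    rcases hx with rfl | rfl
    · rw [rep_reflection_apply ha, sub_sub_cancel_left]
      exact Submodule.neg_mem _ (Submodule.smul_mem _ _ (Submodule.subset_span (by simp)))
    · rw [rep_reflection_apply hb, sub_sub_cancel_left]
      exact Submodule.neg_mem _ (Submodule.smul_mem _ _ (Submodule.subset_span (by simp)))
  | one => simp
  | mul x y _ _ hx hy =>
    rw [rep_mul_apply, ← sub_add_sub_cancel _ (G.rep y v)]
    exact Submodule.add_mem _ (hx _) (hy _)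
  | inv x _ hx =>
    have := Submodule.neg_mem _ (hx (G.rep x⁻¹ v))
    rwa [rep_apply_inv_apply, neg_sub] at this

theorem subRoots_subset_span {a b : V} (ha : a ∈ G.roots) (hb : b ∈ G.roots) :
    G.subRoots (Subgroup.closure {G.reflection a, G.reflection b}) ⊆
      Submodule.span ℝ {a, b} := by
  intro γ hγ
  have h := rep_sub_mem_span ha hb hγ.2 γ
  rw [rep_reflection_self hγ.1] at h
  have h2 := Submodule.smul_mem _ (-(1 / 2) : ℝ) h
  rwa [show (-(1 / 2) : ℝ) • (-γ - γ) = γ by module] at h2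

theorem IsDihedralReflectionSubgroup.canonicallyGenerated
    (h : G.IsDihedralReflectionSubgroup W') : G.CanonicallyGenerated W' := by
  obtain ⟨a, ha, b, hb, -, h⟩ := h
  refine canonicallyGenerated_of_closure (R := {a, b}) ?_ (by rw [h, Set.image_pair])
  rintro x (rfl | rfl)
  exacts [ha.1, hb.1]

/-- Three distinct canonical simple roots would be linearly independent, yet all roots of W' lie in
the span of the two generating roots. -/
theorem IsDihedralReflectionSubgroup.canonical_eq_or_eq (h : G.IsDihedralReflectionSubgroup W')
    {α β γ : V} (hα : α ∈ G.canonicalSimpleRoots W') (hβ : β ∈ G.canonicalSimpleRoots W')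
    (hγ : γ ∈ G.canonicalSimpleRoots W') (hαβ : α ≠ β) : γ = α ∨ γ = β := by
  by_contra! hne
  obtain ⟨a, ha, b, hb, -, rfl⟩ := h
  have hspan := subRoots_subset_span ha.1 hb.1
  have hα' := canonicalSimpleRoots_subset hα
  have hβ' := canonicalSimpleRoots_subset hβ
  have hγ' := canonicalSimpleRoots_subset hγ
  obtain ⟨x₁, y₁, h₁⟩ := Submodule.mem_span_pair.1 (hspan hα'.1)
  obtain ⟨x₂, y₂, h₂⟩ := Submodule.mem_span_pair.1 (hspan hβ'.1)
  obtain ⟨x₃, y₃, h₃⟩ := Submodule.mem_span_pair.1 (hspan hγ'.1)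
  have key := fun {p q r : ℝ} => relation_of_form_nonpos (p := p) (q := q) (r := r)
    hα'.2 hβ'.2 hγ'.2 (form_canonical_nonpos hα hβ hαβ)
    (form_canonical_nonpos hα hγ hne.1.symm) (form_canonical_nonpos hβ hγ hne.2.symm)
  -- The coefficients are the 2×2 minors of the coordinate matrix, as in Cramer's rule.
  have e1 := (key (p := x₂ * y₃ - x₃ * y₂) (q := x₃ * y₁ - x₁ * y₃) (r := x₁ * y₂ - x₂ * y₁) (by
    rw [← h₁, ← h₂, ← h₃]
    module)).2.2
  have e2 := (key (p := x₂) (q := -x₁) (r := 0) (by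
    have : x₂ • α + -x₁ • β + (0 : ℝ) • γ = -(x₁ * y₂ - x₂ * y₁) • b := by
      rw [← h₁, ← h₂]
      module
    rw [this, e1]
    simp)).2.1
  have e3 := (key (p := y₂) (q := -y₁) (r := 0) (by
    have : y₂ • α + -y₁ • β + (0 : ℝ) • γ = (x₁ * y₂ - x₂ * y₁) • a := by
      rw [← h₁, ← h₂]
      module
    rw [this, e1]
    simp)).2.1
  refine ne_zero_of_mem_roots hα'.2.1 ?_
  rw [← h₁, neg_eq_zero.1 e2, neg_eq_zero.1 e3]
  simp

theorem CanonicallyGenerated.nontrivial [Infinite W'] (h : G.CanonicallyGenerated W') :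
    (G.canonicalSimpleRoots W').Nontrivial := by
  by_contra hn
  rw [Set.not_nontrivial_iff] at hn
  have hfin : Finite (Subgroup.closure (G.canonicalReflections W')) := by
    rw [canonicalReflections]
    rcases hn.eq_empty_or_singleton with he | ⟨α, he⟩
    · rw [he, Set.image_empty, Subgroup.closure_empty]
      infer_instance
    · have hα : α ∈ G.canonicalSimpleRoots W' := he ▸ rfl
      rw [he, Set.image_singleton, ← Subgroup.zpowers_eq_closure]
      have : IsOfFinOrder (G.reflection α) := isOfFinOrder_iff_pow_eq_one.2
        ⟨2, two_pos, by rw [pow_two, reflection_mul_self (canonicalSimpleRoots_subset hα).2.1]⟩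
      exact this.finite_zpowers.to_subtype
  exact not_finite_iff_infinite.2 ‹_› (Finite.of_injective _ (Subgroup.inclusion_injective h))

/-- No sequence in the open cone satisfies the recurrence of a nontrivial rotation. -/
theorem recurrence_not_inCone (k : ℕ) : ∀ (t : ℝ) (x : ℕ → V), (∀ n, G.InCone (x n)) →
    x 0 ≠ 0 → (∀ n, x (n + 2) + x n = t • x (n + 1)) → 2 ≤ t ∨ 2 ^ k * (2 - t) ≤ 2 := by
  have base : ∀ (t : ℝ) (x : ℕ → V), (∀ n, G.InCone (x n)) →
      x 0 ≠ 0 → (∀ n, x (n + 2) + x n = t • x (n + 1)) → 0 ≤ t := by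
    intro t x hx h0 hrec
    by_contra! ht
    refine h0 ((hx 0).eq_zero ?_)
    convert (hx 2).add ((hx 1).smul (c := -t) (by linarith)) using 1
    have := hrec 0
    simp only [zero_add] at this
    rw [neg_smul, ← this]
    abel
  induction k with
  | zero =>
    intro t x hx h0 hrec
    have := base t x hx h0 hrec
    right
    linarith
  | succ k ih =>
    intro t x hx h0 hrec
    have ht := base t x hx h0 hrec
    by_contra! hcon
    -- Angle doubling: with t = 2cos θ, the even-indexed terms satisfy the recurrence for t² - 2 =
    -- 2cos 2θ. As t ≥ 0, the gap 2 - t at least doubles.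
    have h1 := ih (t ^ 2 - 2) (fun n => x (2 * n)) (fun n => hx _) h0 (fun n => by
      have e1 := hrec (2 * n)
      have e2 := hrec (2 * n + 1)
      have e3 := hrec (2 * n + 2)
      simp only [show 2 * (n + 2) = 2 * n + 4 by ring, show 2 * (n + 1) = 2 * n + 2 by ring]
      simp only [show 2 * n + 1 + 2 = 2 * n + 3 by ring, show 2 * n + 1 + 1 = 2 * n + 2 by ring,
        show 2 * n + 2 + 2 = 2 * n + 4 by ring] at e1 e2 e3
      have e4 : x (2 * n + 4) = t • x (2 * n + 3) - x (2 * n + 2) := eq_sub_of_add_eq e3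
      have e5 : x (2 * n) = t • x (2 * n + 1) - x (2 * n + 2) := eq_sub_of_add_eq' e1
      have e6 : x (2 * n + 3) = t • x (2 * n + 2) - x (2 * n + 1) := eq_sub_of_add_eq e2
      rw [e4, e5, e6]
      module)
    have hk : (0 : ℝ) < 2 ^ k := by positivity
    rcases h1 with h1 | h1
    · nlinarith
    · rw [pow_succ] at hcon
      nlinarith [mul_nonneg (mul_nonneg hk.le ht) (show 0 ≤ 2 - t by linarith)]

end GeomRep

namespace GeomRep

variable {ι W : Type*} [Fintype ι] [Group W] {M : CoxeterMatrix ι} {cs : CoxeterSystem M W}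
  {V : Type*} [AddCommGroup V] [Module ℝ V] {G : GeomRep cs V} {W' : Subgroup W}

/-! ### Infinite dihedral reflection subgroups -/

theorem eq_or_eq_of_mem_canonicalReflections {α β : V}
    (hpair : G.canonicalSimpleRoots W' = {α, β}) {x : W} (hx : x ∈ G.canonicalReflections W') :
    x = G.reflection α ∨ x = G.reflection β := by
  rw [canonicalReflections, hpair, Set.image_pair] at hx
  exact hx

theorem not_isOfFinOrder_of_infinite [Infinite W'] (hgen : G.CanonicallyGenerated W') {α β : V}
    (hpair : G.canonicalSimpleRoots W' = {α, β}) :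
    ¬ IsOfFinOrder (G.reflection α * G.reflection β) := by
  intro hfin
  have hα := canonicalSimpleRoots_subset (show α ∈ G.canonicalSimpleRoots W' by simp [hpair])
  have hβ := canonicalSimpleRoots_subset (show β ∈ G.canonicalSimpleRoots W' by simp [hpair])
  have hZ := hfin.finite_zpowers
  refine not_finite_iff_infinite.2 ‹Infinite W'› (Set.Finite.to_subtype
    ((hZ.union (hZ.image (· * G.reflection α))).subset fun w hw => ?_))
  obtain ⟨l, hl, rfl⟩ := exists_word hgen hw
  obtain ⟨i, ⟨h, -⟩ | ⟨h, -⟩⟩ := exists_zpow_of_word (reflection_mul_self hα.2.1)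
    (reflection_mul_self hβ.2.1) l fun x hx => eq_or_eq_of_mem_canonicalReflections hpair (hl x hx)
  · exact Or.inl ⟨i, h.symm⟩
  · exact Or.inr ⟨_, ⟨i, rfl⟩, h.symm⟩

theorem zpow_ne_reflection {s : W} (hs : ¬ IsOfFinOrder s) {γ : V} (hγ : γ ∈ G.roots) (i : ℤ) :
    s ^ i ≠ G.reflection γ := by
  intro h
  have h1 := reflection_mul_self hγ
  rw [← h, ← zpow_add, ← zpow_zero s] at h1
  have h2 := injective_zpow_iff_not_isOfFinOrder.2 hs h1
  refine reflection_ne_one hγ ?_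
  rw [← h, show i = 0 by omega, zpow_zero]

/-- Infinite order makes the normal form of a word unique, so every word for w respects the bound
attached to the exponent i. -/
theorem le_subLength_zpow_mul (hgen : G.CanonicallyGenerated W') {α β : V}
    (hpair : G.canonicalSimpleRoots W' = {α, β})
    (hs : ¬ IsOfFinOrder (G.reflection α * G.reflection β)) {w : W} (hw : w ∈ W') {i : ℤ}
    (h : w = (G.reflection α * G.reflection β) ^ i * G.reflection α) :
    |2 * i + 1| ≤ G.subLength W' w := by
  have hα := canonicalSimpleRoots_subset (show α ∈ G.canonicalSimpleRoots W' by simp [hpair])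
  have hβ := canonicalSimpleRoots_subset (show β ∈ G.canonicalSimpleRoots W' by simp [hpair])
  obtain ⟨l, hl, hlw, hlen⟩ := exists_word_length hgen hw
  rw [← hlen]
  obtain ⟨j, ⟨h', -⟩ | ⟨h', h''⟩⟩ := exists_zpow_of_word (reflection_mul_self hα.2.1)
    (reflection_mul_self hβ.2.1) l fun x hx => eq_or_eq_of_mem_canonicalReflections hpair (hl x hx)
  · refine absurd ?_ (zpow_ne_reflection hs hα.2.1 (-i + j))
    rw [zpow_add, ← h', hlw, h, zpow_neg, inv_mul_cancel_left]
  · rw [hlw, h, mul_left_inj] at h'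
    rwa [injective_zpow_iff_not_isOfFinOrder.2 hs h']

theorem subLength_pow_le (hgen : G.CanonicallyGenerated W') {α β : V}
    (hα : α ∈ G.canonicalSimpleRoots W') (hβ : β ∈ G.canonicalSimpleRoots W') (n : ℕ) :
    G.subLength W' ((G.reflection α * G.reflection β) ^ n) ≤ 2 * n := by
  have hα' := (canonicalSimpleRoots_subset hα).1.2
  have hβ' := (canonicalSimpleRoots_subset hβ).1.2
  have hmem := W'.mul_mem hα' hβ'
  induction n with
  | zero => simpa using subLength_le (G := G) (W' := W') (l := []) (by simp)
  | succ n ih =>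
    rw [pow_succ]
    have h1 := subLength_mul_le hgen (W'.pow_mem hmem n) hmem
    have h2 := subLength_mul_le hgen hα' hβ'
    have h3 := subLength_reflection_le hα
    have h4 := subLength_reflection_le hβ
    omega

theorem rep_pow_pos (hgen : G.CanonicallyGenerated W') {α β : V}
    (hpair : G.canonicalSimpleRoots W' = {α, β})
    (hs : ¬ IsOfFinOrder (G.reflection α * G.reflection β)) (n : ℕ) :
    G.rep ((G.reflection α * G.reflection β) ^ n) α ∈ G.posRoots := by
  have hα : α ∈ G.canonicalSimpleRoots W' := by simp [hpair]
  have hβ : β ∈ G.canonicalSimpleRoots W' := by simp [hpair]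
  have hα' := canonicalSimpleRoots_subset hα
  have hmem := W'.pow_mem (W'.mul_mem hα'.1.2 (canonicalSimpleRoots_subset hβ).1.2) n
  refine pos_of_not_neg (rep_mem_roots hα'.2.1 _) fun hneg => ?_
  have h1 := subLength_mul_reflection_lt hgen hmem hα hneg
  have h2 := subLength_pow_le hgen hα hβ n
  have h3 := le_subLength_zpow_mul hgen hpair hs (W'.mul_mem hmem hα'.1.2) (i := n)
    (by rw [zpow_natCast])
  rw [abs_of_nonneg (by positivity)] at h3
  omega

/-- If -1 < B(α,β) ≤ 0, then s_α s_β would act as a nontrivial rotation, while all (s_α s_β)^n α are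
positive; `recurrence_not_inCone` forbids this. -/
theorem form_le_neg_one (hgen : G.CanonicallyGenerated W') {α β : V} (hne : α ≠ β)
    (hpair : G.canonicalSimpleRoots W' = {α, β})
    (hs : ¬ IsOfFinOrder (G.reflection α * G.reflection β)) : G.form α β ≤ -1 := by
  have hα : α ∈ G.canonicalSimpleRoots W' := by simp [hpair]
  have hβ : β ∈ G.canonicalSimpleRoots W' := by simp [hpair]
  have hα' := (canonicalSimpleRoots_subset hα).2.1
  have hβ' := (canonicalSimpleRoots_subset hβ).2.1
  have hle := form_canonical_nonpos hα hβ hne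
  have hsymm := G.form_symm β α
  by_contra! hc
  set c := G.form α β with hcdef
  -- The number 4c² - 2 is the trace of s_α s_β on the plane of α and β, where its determinant is 1;
  -- Cayley–Hamilton gives the recurrence `hrec`. The integer k is chosen to violate the bound.
  have ht : 4 * c ^ 2 - 2 < 2 := by nlinarith
  obtain ⟨k, hk⟩ := pow_unbounded_of_one_lt (2 / (2 - (4 * c ^ 2 - 2))) one_lt_two
  rw [div_lt_iff₀ (by linarith)] at hk
  have hrec : ∀ v, v = α → G.rep (G.reflection α) (G.rep (G.reflection β)
      (G.rep (G.reflection α) (G.rep (G.reflection β) v))) + v =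
      (4 * c ^ 2 - 2) • G.rep (G.reflection α) (G.rep (G.reflection β) v) := by
    rintro v rfl
    simp only [rep_reflection_apply hα', rep_reflection_apply hβ', map_sub, map_smul,
      form_self hα', form_self hβ', hsymm, ← hcdef, smul_eq_mul]
    module
  rcases recurrence_not_inCone k (4 * c ^ 2 - 2)
    (fun n => G.rep ((G.reflection α * G.reflection β) ^ n) α)
    (fun n => (rep_pow_pos hgen hpair hs n).2)
    (ne_zero_of_mem_roots (rep_pow_pos hgen hpair hs 0).1) (fun n => by
      have := congrArg (G.rep ((G.reflection α * G.reflection β) ^ n)) (hrec α rfl)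
      rw [map_add, map_smul] at this
      simpa only [← rep_mul_apply, pow_succ, mul_assoc] using this) with h | h <;> linarith

/-- The reflection s_γ has the form (s_α s_β)^i s_α. An exponent i = n ≥ 0 gives the chain starting
at α, and i = -(n+1) the chain starting at β; in both cases |2i + 1| = 2n + 1. -/
theorem exists_eq_rootChain (hgen : G.CanonicallyGenerated W') {α β : V}
    (hpair : G.canonicalSimpleRoots W' = {α, β}) (hB : G.form α β ≤ -1)
    (hs : ¬ IsOfFinOrder (G.reflection α * G.reflection β)) {γ : V}
    (hγ : γ ∈ G.subPosRoots W') :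
    ∃ n : ℕ, (γ = G.rootChain n α β ∨ γ = G.rootChain n β α) ∧
      2 * n + 1 ≤ G.subLength W' (G.reflection γ) := by
  have hα := canonicalSimpleRoots_subset (show α ∈ G.canonicalSimpleRoots W' by simp [hpair])
  have hβ := canonicalSimpleRoots_subset (show β ∈ G.canonicalSimpleRoots W' by simp [hpair])
  have hB' : G.form β α ≤ -1 := by rwa [G.form_symm]
  obtain ⟨l, hl, hlw⟩ := exists_word hgen hγ.1.2
  obtain ⟨i, ⟨h, -⟩ | ⟨h, -⟩⟩ := exists_zpow_of_word (reflection_mul_self hα.2.1)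
    (reflection_mul_self hβ.2.1) l fun x hx => eq_or_eq_of_mem_canonicalReflections hpair (hl x hx)
  · exact absurd (h.symm.trans hlw) (zpow_ne_reflection hs hγ.2.1 i)
  rw [hlw] at h
  have hlen := le_subLength_zpow_mul hgen hpair hs hγ.1.2 h
  obtain ⟨n, rfl | hn⟩ : ∃ n : ℕ, i = n ∨ i = -(n + 1 : ℕ) := by
    rcases le_or_gt 0 i with hi | hi
    · exact ⟨i.toNat, Or.inl (by omega)⟩
    · exact ⟨(-i - 1).toNat, Or.inr (by omega)⟩
  · refine ⟨n, Or.inl (reflection_injOn hγ.2 (rootChain_pos hα.2 hβ.2 hB n) ?_), by grind⟩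
    rw [h, reflection_rootChain hα.2.1 hβ.2.1, zpow_natCast]
  · refine ⟨n, Or.inr (reflection_injOn hγ.2 (rootChain_pos hβ.2 hα.2 hB' n) ?_), by grind⟩
    rw [h, hn, reflection_rootChain hβ.2.1 hα.2.1, zpow_neg, zpow_natCast, ← inv_pow, mul_inv_rev,
      reflection_inv hα.2.1, reflection_inv hβ.2.1, pow_succ]
    simp [mul_assoc, reflection_mul_self hα.2.1]

theorem subLength_rootChain_le (hgen : G.CanonicallyGenerated W') {α β : V}
    (hα : α ∈ G.canonicalSimpleRoots W') (hβ : β ∈ G.canonicalSimpleRoots W') (n : ℕ) :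
    G.subLength W' (G.reflection (G.rootChain n α β)) ≤ 2 * n + 1 ∧
      G.rootChain n α β ∈ G.subRoots W' := by
  have hα' := canonicalSimpleRoots_subset hα
  induction n generalizing α β with
  | zero => exact ⟨subLength_reflection_le hα, hα'.1⟩
  | succ n ih =>
    obtain ⟨h1, h2⟩ := ih hβ hα (canonicalSimpleRoots_subset hβ)
    refine ⟨?_, rep_mem_subRoots h2 hα'.1.2⟩
    have := subLength_reflection_rep_le hgen h2 hα
    rw [rootChain]
    omega

theorem infDepth_lt_of_subLength_lt (h : G.IsDihedralReflectionSubgroup W') [Infinite W']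
    {γ δ : V} (hγ : γ ∈ G.subPosRoots W') (hδ : δ ∈ G.subPosRoots W')
    (hlt : G.subLength W' (G.reflection γ) < G.subLength W' (G.reflection δ)) :
    G.infDepth γ < G.infDepth δ := by
  have hgen := h.canonicallyGenerated
  obtain ⟨α, hα, β, hβ, hne⟩ := hgen.nontrivial
  have hpair : G.canonicalSimpleRoots W' = {α, β} := by
    refine Set.Subset.antisymm (fun x hx => h.canonical_eq_or_eq hα hβ hx hne) ?_
    rintro x (rfl | rfl)
    exacts [hα, hβ]
  have hs := not_isOfFinOrder_of_infinite hgen hpair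
  have hB := form_le_neg_one hgen hne hpair hs
  have hB' : G.form β α ≤ -1 := by rwa [G.form_symm]
  obtain ⟨m, hm, hml⟩ := exists_eq_rootChain hgen hpair hB hs hγ
  obtain ⟨n, hn, -⟩ := exists_eq_rootChain hgen hpair hB hs hδ
  have hnl : G.subLength W' (G.reflection δ) ≤ 2 * n + 1 := by
    rcases hn with rfl | rfl
    · exact (subLength_rootChain_le hgen hα hβ n).1
    · exact (subLength_rootChain_le hgen hβ hα n).1
  -- The lower length bound for γ is 2m + 1 and the upper one for δ is 2n + 1.
  have hmn : m < n := by omega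
  have h1 := infDepth_rootChain_lt (canonicalSimpleRoots_subset hα).2
    (canonicalSimpleRoots_subset hβ).2 hB hmn
  have h2 := infDepth_rootChain_lt (canonicalSimpleRoots_subset hβ).2
    (canonicalSimpleRoots_subset hα).2 hB' hmn
  rcases hm with rfl | rfl <;> rcases hn with rfl | rfl
  exacts [h1.1, h1.2, h2.2, h2.1]

end GeomRep

theorem mainTheorem7 {ι W V : Type*} [Fintype ι] [Group W] {M : CoxeterMatrix ι}
    {cs : CoxeterSystem M W} [AddCommGroup V] [Module ℝ V] (G : GeomRep cs V)
    (W' : Subgroup W) (hW' : G.IsDihedralReflectionSubgroup W')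
    (γ δ : V) (hγ : γ ∈ G.subPosRoots W') (hδ : δ ∈ G.subPosRoots W') :
    (Infinite W' →
      G.subLength W' (G.reflection γ) < G.subLength W' (G.reflection δ) →
        G.infDepth γ < G.infDepth δ) ∧
    (Finite W' →
      (∃ x ∈ W', δ = G.rep x γ ∧
        G.subLength W' (G.reflection δ) =
          G.subLength W' (G.reflection γ) + 2 * G.subLength W' x) →
        G.infDepth γ ≤ G.infDepth δ) := by
  refine ⟨fun _ h => GeomRep.infDepth_lt_of_subLength_lt hW' hγ hδ h, ?_⟩
  rintro - ⟨x, hx, rfl, h⟩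
  obtain ⟨l, hl, rfl, hlen⟩ := GeomRep.exists_word_length hW'.canonicallyGenerated hx
  rw [← hlen] at h
  exact ((GeomRep.infDepth_le_of_word hW'.canonicallyGenerated hγ l hl).2 h).2
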